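/- Let $\mathcal X,\mathcal A$ be finite sets with $|\mathcal A|\ge 2$, $\gamma\in[0,1)$, and consider a linear MDP: rewards $r(x,a)=\langle\varphi(x,a),\omega\rangle\in[0,1]$ and transition probabilities $p(x'\mid x,a)=\langle\varphi(x,a),\psi(x')\rangle$ with $\varphi(x,a),\psi(x'),\omega\in\mathbb R^d$, and initial-state distribution $\nu_0$. For a policy $\pi:\mathcal X\to\Delta_{\mathcal A}$ let $\nu^\pi(x)=(1-\gamma)\sum_{t\ge0}\gamma^t\,\mathbb P_\pi(X_t=x)$ (with $X_0\sim\nu_0$), $\mu^\pi(x,a)=\pi(a\mid x)\nu^\pi(x)$, let $v^\pi$ be its discounted value function and $\theta^\pi=\omega+\gamma\sum_x v^\pi(x)\psi(x)$, so that $q^\pi(x,a)=\langle\varphi(x,a),\theta^\pi\rangle$. Let $\pi_B$ be a behavior policy, $\mu_B=\mu^{\pi_B}$, and suppose that $\Lambda=\mathbb E_{(X,A)\sim\mu_B}[\varphi(X,A)\varphi(X,A)^{\mathsf T}]$ is invertible. For $c\in\{1/2,1\}$ and a comparator policy $\pi^*$ put $C_{\varphi,c}(\pi^*;\pi_B)=\mathbb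 E_{\mu^{\pi^*}}[\varphi]^{\mathsf T}\Lambda^{-2c}\,\mathbb E_{\mu^{\pi^*}}[\varphi]$. **Algorithm** (inputs $T,K\ge1$, $\alpha,\zeta,\eta>0$, radii $D_\theta,D_\beta$, any $\theta_0,\beta_1$ with $\|\theta_0\|_2\le D_\theta$, $\|\beta_1\|_2\le D_\beta$). It uses $n=KT$ i.i.d. observations $(X^0,X,A,R,X')$ with $X^0\sim\nu_0$ independent of $(X,A,X')$, $(X,A)\sim\mu_B$, $R=r(X,A)$, $X'\sim p(\cdot\mid X,A)$; each round uses $K$ fresh ones. Write $\Pi_D$ for the Euclidean projection onto $\{\|y\|_2\le D\}$. In round $t=1,\dots,T$ let $\pi_t(a\mid x)\propto\exp\bigl(\alpha\sum_{i<t}\langle\varphi(x,a),\theta_i\rangle\bigr)$ and $\theta_{t,1}=\theta_{t-1}$. For $k=1,\dots,K-1$, with a fresh observation and $\varphi_{t,k}=\varphi(X_{t,k},A_{t,k})$, set $$\theta_{t,k+1}=\Pi_{D_\theta}\Bigl(\theta_{t,k}-\eta\Bigl[\sum_{x,a}\mu_{t,k}(x,a)\varphi(x,a)-\varphi_{t,k}\langle\varphi_{t,k},\Lambda^{c-1}\beta_t\rangle\Bigr]\Bigr),$$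 where $\mu_{t,k}(x,a)=\pi_t(a\mid x)\bigl((1-\gamma)\mathbb 1\{X^0_{t,k}=x\}+\gamma\langle\varphi_{t,k},\Lambda^{c-1}\beta_t\rangle\mathbb 1\{X'_{t,k}=x\}\bigr)$. Then set $\theta_t=\frac1K\sum_{k=1}^K\theta_{t,k}$ and, with one more observation, $\varphi_t=\varphi(X_t,A_t)$ and $v_t(x)=\sum_a\pi_t(a\mid x)\langle\varphi(x,a),\theta_t\rangle$, $$\beta_{t+1}=\Pi_{D_\beta}\bigl(\beta_t+\zeta\,\Lambda^{c-1}\varphi_t\,(R_t+\gamma v_t(X'_t)-\langle\varphi_t,\theta_t\rangle)\bigr).$$ The output is $\pi_{\mathrm{out}}=\pi_J$ with $J$ uniform on $\{1,\dots,T\}$ and independent of the data. **Statement.** For all constants $B,\kappa>0$ there is a constant $M>0$, depending only on $B$ and $\kappa$, with the following property. Let $c\in\{1/2,1\}$ and $0<\varepsilon\le 1$. Assume $\|\varphi(x,a)\|_2\le D_\varphi\le B$ for all $x,a$ (that is, $D_\varphi=O(1)$), $\|\omega\|_2\le D_\omega=\sqrt d$, $\|\sum_x\psi(x)\|_2\le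 D_\psi=\sqrt d$, $\|\theta^\pi\|_2\le D_\theta:=D_\omega+\frac{D_\psi}{1-\gamma}$ for every policy $\pi$, $C_{\varphi,c}(\pi^*;\pi_B)\le D_\beta^2$, and $D_\beta=\kappa\sqrt{C_{\varphi,c}(\pi^*;\pi_B)}$. Then there are $\alpha,\zeta,\eta>0$ and integers $K,T\ge1$, depending only on $B,\kappa,c,d,\gamma,|\mathcal A|,D_\varphi,D_\beta,\varepsilon$ (and not otherwise on the MDP or the policies), such that the algorithm satisfies $\mathbb E\bigl[\langle\mu^{\pi^*}-\mu^{\pi_{\mathrm{out}}},r\rangle\bigr]\le\varepsilon$ and its number of samples $n_\varepsilon=KT$ obeys $$n_\varepsilon\le M\,\frac{d^4\,C_{\varphi,c}(\pi^*;\pi_B)^2\,\log|\mathcal A|}{d^{2c}(1-\gamma)^4\varepsilon^4}.$$ -/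

import Mathlib

namespace OfflineRL

noncomputable section

/-- Feature vectors and parameters live in `ℝ^d` with the Euclidean norm. -/
abbrev Vec (d : ℕ) : Type := EuclideanSpace ℝ (Fin d)

/-- A linear MDP with finite state space `X`, finite action space `A`, feature dimension `d` and
discount factor `γ`, together with its initial-state distribution `ν₀`. Transition probabilities
are `p x a x'` and rewards `r x a`. -/
structure LinearMDP (X A : Type*) [Fintype X] (d : ℕ) (γ : ℝ) where
  p : X → A → X → ℝ
  r : X → A → ℝ
  ν₀ : X → ℝ
  φ : X → A → Vec d
  ψ : X → Vec d
  ω : Vec d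
  p_mem : ∀ x a, p x a ∈ stdSimplex ℝ X
  r_mem : ∀ x a, r x a ∈ Set.Icc (0 : ℝ) 1
  ν₀_mem : ν₀ ∈ stdSimplex ℝ X
  r_eq : ∀ x a, r x a = inner ℝ (φ x a) ω
  p_eq : ∀ x a x', p x a x' = inner ℝ (φ x a) (ψ x')

/-- A stationary randomized policy: `π x a` is the probability of action `a` in state `x`. -/
def IsPolicy {X A : Type*} [Fintype A] (π : X → A → ℝ) : Prop :=
  ∀ x, π x ∈ stdSimplex ℝ A

/-- Real power of a symmetric matrix, by the functional calculus. -/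
def matPow {d : ℕ} (S : Matrix (Fin d) (Fin d) ℝ) (s : ℝ) : Matrix (Fin d) (Fin d) ℝ :=
  cfc (fun x : ℝ => x ^ s) S

/-- Matrix-vector product on Euclidean space. -/
def mulV {d : ℕ} (S : Matrix (Fin d) (Fin d) ℝ) (v : Vec d) : Vec d :=
  Matrix.toEuclideanLin S v

/-- Euclidean projection onto the closed ball of radius `D` centred at the origin. -/
def projBall {d : ℕ} (D : ℝ) (y : Vec d) : Vec d :=
  if ‖y‖ ≤ D then y else (D / ‖y‖) • y

/-- One observation: an initial state `x₀`, a state-action pair `(x, a)` and a next state `x'`.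
The observed reward is the deterministic reward at `(x, a)`. -/
structure Obs (X A : Type*) where
  x₀ : X
  x : X
  a : A
  x' : X

instance {X A : Type*} : MeasurableSpace (Obs X A) := ⊤

namespace LinearMDP

variable {X A : Type*} [Fintype X] [Fintype A] [DecidableEq X] [DecidableEq A]
  {d : ℕ} {γ : ℝ}

/-- Law of `(X_t, A_t)` when `(X_0, A_0)` has law `μ₀`, `X_{t+1} ∼ p(· | X_t, A_t)` and
`A_{t+1} ∼ π(· | X_{t+1})`. -/
def saDist (M : LinearMDP X A d γ) (π : X → A → ℝ) (μ₀ : X → A → ℝ) : ℕ → X → A → ℝ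
  | 0 => μ₀
  | t + 1 => fun y b => (∑ x, ∑ a, M.saDist π μ₀ t x a * M.p x a y) * π y b

/-- `q^π(x,a) = E_π[∑_t γ^t r(X_t,A_t) | X_0 = x, A_0 = a]`. -/
def qValue (M : LinearMDP X A d γ) (π : X → A → ℝ) (x : X) (a : A) : ℝ :=
  ∑' t : ℕ, γ ^ t *
    ∑ y, ∑ b, M.saDist π (fun y b => if y = x ∧ b = a then 1 else 0) t y b * M.r y b

/-- `v^π(x) = E_{A_0 ∼ π(·|x)}[q^π(x, A_0)]`. -/
def vValue (M : LinearMDP X A d γ) (π : X → A → ℝ) (x : X) : ℝ :=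
  ∑ a, π x a * M.qValue π x a

/-- State occupancy measure `ν^π(x) = (1-γ) ∑_t γ^t P_π(X_t = x)`, with `X_0 ∼ ν₀`. -/
def stateOcc (M : LinearMDP X A d γ) (π : X → A → ℝ) (x : X) : ℝ :=
  (1 - γ) * ∑' t : ℕ, γ ^ t * ∑ a, M.saDist π (fun y b => M.ν₀ y * π y b) t x a

/-- State-action occupancy measure `μ^π(x,a) = π(a|x) ν^π(x)`. -/
def occ (M : LinearMDP X A d γ) (π : X → A → ℝ) (x : X) (a : A) : ℝ :=
  π x a * M.stateOcc π x

/-- The parameter of the action-value function: `q^π = Φ θ^π` with `θ^π = ω + γ Ψ v^π`. -/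
def thetaOf (M : LinearMDP X A d γ) (π : X → A → ℝ) : Vec d :=
  M.ω + γ • ∑ x, M.vValue π x • M.ψ x

/-- `Λ = E_{(X,A) ∼ μ_B}[φ(X,A) φ(X,A)ᵀ]`, with `μ_B` the occupancy measure of `πB`. -/
def cov (M : LinearMDP X A d γ) (πB : X → A → ℝ) : Matrix (Fin d) (Fin d) ℝ :=
  Matrix.of fun i j => ∑ x, ∑ a, M.occ πB x a * (M.φ x a i * M.φ x a j)

/-- Mean feature vector `E_{(X,A) ∼ μ^π}[φ(X,A)]`. -/
def meanFeature (M : LinearMDP X A d γ) (π : X → A → ℝ) : Vec d :=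
  ∑ x, ∑ a, M.occ π x a • M.φ x a

/-- Generalized coverage ratio
`C_{φ,c}(π; πB) = E_{μ^π}[φ]ᵀ Λ^{-2c} E_{μ^π}[φ]`. -/
def coverage (M : LinearMDP X A d γ) (c : ℝ) (π πB : X → A → ℝ) : ℝ :=
  inner ℝ (M.meanFeature π) (mulV (matPow (M.cov πB) (-(2 * c))) (M.meanFeature π))

/-- Probability of an observation: `X⁰ ∼ ν₀`, `(X, A) ∼ μ_B` independently of `X⁰`, and
`X' ∼ p(· | X, A)`. -/
def obsProb (M : LinearMDP X A d γ) (πB : X → A → ℝ) (o : Obs X A) : ℝ :=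
  M.ν₀ o.x₀ * M.occ πB o.x o.a * M.p o.x o.a o.x'

/-- Softmax policy `π(a|x) ∝ exp(α ⟨φ(x,a), S⟩)`. -/
def softmax (M : LinearMDP X A d γ) (α : ℝ) (S : Vec d) (x : X) (a : A) : ℝ :=
  Real.exp (α * inner ℝ (M.φ x a) S) / ∑ b, Real.exp (α * inner ℝ (M.φ x b) S)

end LinearMDP

/-- Inputs of the primal-dual algorithm: exponent `c`, learning rates `α, ζ, η`, radii of the
feasible balls, number `K` of samples per round, and initial points `θ₀, β₁`. -/
structure Config (d : ℕ) where
  c : ℝ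
  α : ℝ
  ζ : ℝ
  η : ℝ
  Dθ : ℝ
  Dβ : ℝ
  K : ℕ
  θ₀ : Vec d
  β₁ : Vec d

/-- State of the algorithm at the start of round `t`: `θ = θ_{t-1}`, `β = β_t` and
`S = ∑_{i < t} θ_i`, which represents the policy `π_t`. -/
structure AlgState (d : ℕ) where
  θ : Vec d
  β : Vec d
  S : Vec d

namespace LinearMDP

variable {X A : Type*} [Fintype X] [Fintype A] [DecidableEq X] [DecidableEq A]
  {d : ℕ} {γ : ℝ}

/-- `μ_{t,k}(x,a) = π(a|x) ((1-γ) 1{X⁰ = x} + γ ⟨φ(X,A), Λ^{c-1} β⟩ 1{X' = x})`. -/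
def muEst (M : LinearMDP X A d γ) (πB : X → A → ℝ) (c : ℝ) (π : X → A → ℝ) (β : Vec d)
    (o : Obs X A) (x : X) (a : A) : ℝ :=
  π x a * ((1 - γ) * (if o.x₀ = x then 1 else 0) +
    γ * inner ℝ (M.φ o.x o.a) (mulV (matPow (M.cov πB) (c - 1)) β) *
      (if o.x' = x then 1 else 0))

/-- Stochastic gradient for `θ`:
`Φᵀ μ_{t,k} - φ(X,A) ⟨φ(X,A), Λ^{c-1} β⟩`. -/
def gTheta (M : LinearMDP X A d γ) (πB : X → A → ℝ) (c : ℝ) (π : X → A → ℝ) (β : Vec d)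
    (o : Obs X A) : Vec d :=
  (∑ x, ∑ a, M.muEst πB c π β o x a • M.φ x a) -
    (inner ℝ (M.φ o.x o.a) (mulV (matPow (M.cov πB) (c - 1)) β)) • M.φ o.x o.a

/-- Stochastic gradient for `β`: `Λ^{c-1} φ(X,A) (R + γ v(X') - ⟨φ(X,A), θ⟩)`, where
`R = r(X,A)` is the observed reward and `v(x) = ∑_a π(a|x) ⟨φ(x,a), θ⟩`. -/
def gBeta (M : LinearMDP X A d γ) (πB : X → A → ℝ) (c : ℝ) (π : X → A → ℝ) (θ : Vec d)
    (o : Obs X A) : Vec d :=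
  (M.r o.x o.a + γ * (∑ a, π o.x' a * inner ℝ (M.φ o.x' a) θ) - inner ℝ (M.φ o.x o.a) θ) •
    mulV (matPow (M.cov πB) (c - 1)) (M.φ o.x o.a)

/-- Inner-loop iterates of a round entered in state `s` and fed with the observations `W`;
index `k` here is index `k + 1` in the usual one-based numbering. -/
def innerIter (M : LinearMDP X A d γ) (πB : X → A → ℝ) (C : Config d) (s : AlgState d)
    (W : ℕ → Obs X A) : ℕ → Vec d
  | 0 => s.θ
  | k + 1 => projBall C.Dθ (M.innerIter πB C s W k -
      C.η • M.gTheta πB C.c (M.softmax C.α s.S) s.β (W k))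

/-- Average `θ_t` of the `K` inner-loop iterates, which use the observations `W 0, …, W (K-2)`. -/
def thetaAvg (M : LinearMDP X A d γ) (πB : X → A → ℝ) (C : Config d) (s : AlgState d)
    (W : ℕ → Obs X A) : Vec d :=
  (1 / (C.K : ℝ)) • ∑ k ∈ Finset.range C.K, M.innerIter πB C s W k

/-- One round of the algorithm. The ascent step on `β` uses the last observation `W (K-1)`,
so a round uses `K` observations. -/
def step (M : LinearMDP X A d γ) (πB : X → A → ℝ) (C : Config d) (s : AlgState d)
    (W : ℕ → Obs X A) : AlgState d where
  θ := M.thetaAvg πB C s W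
  β := projBall C.Dβ (s.β +
    C.ζ • M.gBeta πB C.c (M.softmax C.α s.S) (M.thetaAvg πB C s W) (W (C.K - 1)))
  S := s.S + M.thetaAvg πB C s W

/-- State after `t` rounds; round number `t` (from zero) is fed with `W t 0, …, W t (K-1)`. -/
def run (M : LinearMDP X A d γ) (πB : X → A → ℝ) (C : Config d)
    (W : ℕ → ℕ → Obs X A) : ℕ → AlgState d
  | 0 => ⟨C.θ₀, C.β₁, 0⟩
  | t + 1 => M.step πB C (M.run πB C W t) (W t)

/-- Policy played in round number `t` (from zero): the softmax of `α ∑ Φ θ_i` over the earlier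
rounds. The first one is uniform. -/
def policy (M : LinearMDP X A d γ) (πB : X → A → ℝ) (C : Config d)
    (W : ℕ → ℕ → Obs X A) (t : ℕ) : X → A → ℝ :=
  M.softmax C.α (M.run πB C W t).S

end LinearMDP

open MeasureTheory ProbabilityTheory in
/-- `W t k`, for `t < T` and `k < K`, are `T * K` independent observations collected by the
behaviour policy `πB`, and `J` is uniform on the `T` rounds and independent of the data. Nothing
is required of `W` outside this range of indices. -/
structure IsSampling {X A : Type*} [Fintype X] [Fintype A] [DecidableEq X] [DecidableEq A]
    {d : ℕ} {γ : ℝ} (M : LinearMDP X A d γ) (πB : X → A → ℝ) {T K : ℕ}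
    {Ω : Type*} [MeasurableSpace Ω] (P : Measure Ω)
    (W : ℕ → ℕ → Ω → Obs X A) (J : Ω → Fin T) : Prop where
  measurable_data : ∀ i : Fin T × Fin K, Measurable (W i.1 i.2)
  measurable_index : Measurable J
  indep : iIndepFun (fun i : Fin T × Fin K => W i.1 i.2) P
  law : ∀ (i : Fin T × Fin K) (o : Obs X A), P.real (W i.1 i.2 ⁻¹' {o}) = M.obsProb πB o
  index_indep : IndepFun J (fun w (i : Fin T × Fin K) => W i.1 i.2 w) P
  index_law : ∀ j : Fin T, P.real (J ⁻¹' {j}) = 1 / (T : ℝ)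

end

end OfflineRL

namespace OfflineRL

set_option linter.unusedSectionVars false

noncomputable section

/-! ### Discounted sums, occupancy measures and Bellman equations. -/

namespace LinearMDP

variable {X A : Type*} [Fintype X] [Fintype A] [DecidableEq X] [DecidableEq A]
  {d : ℕ} {γ : ℝ}

/-! The algorithm is a stochastic primal-dual method for the Lagrangian `(1-γ)⟨ν₀, v⟩ + ⟨l, ω + γΨv
- θ⟩`, where `v(x) = ∑ₐ π(a|x)⟨φ(x,a), θ⟩` and `l = Λ^c β` stands for a feature occupancy vector. At
`θ = θ^π` the Bellman residual vanishes and the Lagrangian equals the normalized return of `π`,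
whatever `l` is. At `l = E_{μ^{π*}}[φ]` the flow constraint turns it into the return of `π*` plus
the regret of the policy player. Hence the identity `suboptimality_eq`: for arbitrary `l` and `θ`,
the suboptimality of `π` is the sum of three regrets, of the policy against `π*`, of `β` against
`Λ^{-c} E_{μ^{π*}}[φ]`, and of `θ` against `θ^π`.

Each regret has a potential. For the policy it is a log-partition function
(`Admissible.policy_step`); for `β` and `θ` it is the squared distance to the comparator
(`Admissible.beta_step`, `Admissible.theta_step`). The comparator `θ^{π_t}` moves with `t`, so its
regret is paid off separately in every round; this is the role of the inner loop of length `K`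
(`Admissible.integral_lagrangianDeriv_le`). The other two telescope over the `T` rounds
(`Admissible.integral_suboptimality_le`). Fresh observations make the gradients conditionally
unbiased (`integral_fresh_obs`).

The preconditioning by `Λ^{c-1}` is chosen so that the comparator of `β` has squared norm equal to
the coverage ratio, while the gradients have second moments free of `Λ^{-1}`: of order `Dβ²` for `θ`
and `Dθ² d^{2-2c}` for `β`. Balancing gives `K` of order `Dβ² Dθ² / ε²` and `T` of order `d^{2-2c}
Dβ² Dθ² log|A| / ε²`; with `Dθ ≤ 2√d/(1-γ)` the product is the claimed count. Lower-order terms and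
the rounding to integers are absorbed because the coverage ratio is bounded below
(`one_le_mul_coverage`). -/

lemma hasSum_discounted (hγ : 0 ≤ γ) (hγ1 : γ < 1) {u : ℕ → ℝ} {C : ℝ} (hu : ∀ t, |u t| ≤ C) :
    HasSum (fun t => γ ^ t * u t) (∑' t, γ ^ t * u t) := by
  refine Summable.hasSum (Summable.of_norm_bounded
    ((summable_geometric_of_lt_one hγ hγ1).mul_right C) fun t => ?_)
  rw [Real.norm_eq_abs, abs_mul, abs_of_nonneg (pow_nonneg hγ t)]
  exact mul_le_mul_of_nonneg_left (hu t) (pow_nonneg hγ t)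

/-- If `u₀ = a` and `u_{t+1}(i) = ∑ⱼ k(i,j) u_t(j)`, the discounted sums `U(i) = ∑ γᵗ u_t(i)`
satisfy `U = a + γ k U`. -/
lemma discounted_sum_fixed_point {ι : Type*} [Fintype ι] {u : ℕ → ι → ℝ}
    {U : ι → ℝ} {k : ι → ι → ℝ} (hU : ∀ i, HasSum (fun t => γ ^ t * u t i) (U i))
    (hu : ∀ t i, u (t + 1) i = ∑ j, k i j * u t j) (i : ι) :
    U i = u 0 i + γ * ∑ j, k i j * U j := by
  have h1 : HasSum (fun t => γ ^ (t + 1) * u (t + 1) i) (γ * ∑ j, k i j * U j) := by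
    have h : HasSum (fun t => γ * ∑ j, k i j * (γ ^ t * u t j)) (γ * ∑ j, k i j * U j) :=
      (hasSum_sum (s := Finset.univ) fun j _ => (hU j).mul_left (k i j)).mul_left γ
    convert h using 2 with t
    rw [hu, Finset.mul_sum, Finset.mul_sum]
    exact Finset.sum_congr rfl fun j _ => by ring
  have h2 := (hasSum_nat_add_iff (f := fun t => γ ^ t * u t i) 1).1 h1
  rw [(hU i).unique h2]
  simp [add_comm]

lemma saDist_nonneg (M : LinearMDP X A d γ) {π μ₀ : X → A → ℝ} (hπ : IsPolicy π)
    (h₀ : ∀ x a, 0 ≤ μ₀ x a) (t : ℕ) (x : X) (a : A) : 0 ≤ M.saDist π μ₀ t x a := by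
  induction t generalizing x a with
  | zero => exact h₀ x a
  | succ t ih =>
    exact mul_nonneg (Finset.sum_nonneg fun y _ => Finset.sum_nonneg fun b _ =>
      mul_nonneg (ih y b) ((M.p_mem y b).1 x)) ((hπ x).1 a)

lemma sum_sum_saDist (M : LinearMDP X A d γ) {π μ₀ : X → A → ℝ} (hπ : IsPolicy π) (t : ℕ) :
    ∑ x, ∑ a, M.saDist π μ₀ t x a = ∑ x, ∑ a, μ₀ x a := by
  induction t with
  | zero => rfl
  | succ t ih =>
    rw [← ih]
    simp only [saDist, ← Finset.mul_sum, (hπ _).2, mul_one]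
    rw [Finset.sum_comm]
    refine Finset.sum_congr rfl fun x _ => ?_
    rw [Finset.sum_comm]
    refine Finset.sum_congr rfl fun a _ => ?_
    rw [← Finset.mul_sum, (M.p_mem x a).2, mul_one]

section Occupancy

variable (M : LinearMDP X A d γ) {π : X → A → ℝ}

/-- Law of `X_t` under `π`, with `X_0 ∼ ν₀`. -/
def stateDist (π : X → A → ℝ) (t : ℕ) (x : X) : ℝ :=
  ∑ a, M.saDist π (fun y b => M.ν₀ y * π y b) t x a

lemma saDist_eq_stateDist_mul (hπ : IsPolicy π) (t : ℕ) (x : X) (a : A) :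
    M.saDist π (fun y b => M.ν₀ y * π y b) t x a = M.stateDist π t x * π x a := by
  cases t with
  | zero => simp [stateDist, saDist, ← Finset.mul_sum, (hπ x).2]
  | succ t => simp only [stateDist, saDist, ← Finset.mul_sum, (hπ x).2, mul_one]

lemma stateDist_zero (hπ : IsPolicy π) (x : X) : M.stateDist π 0 x = M.ν₀ x := by
  simp [stateDist, saDist, ← Finset.mul_sum, (hπ x).2]

lemma stateDist_succ (hπ : IsPolicy π) (t : ℕ) (y : X) :
    M.stateDist π (t + 1) y = ∑ x, (∑ a, π x a * M.p x a y) * M.stateDist π t x := by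
  have : M.stateDist π (t + 1) y
      = ∑ x, ∑ a, M.saDist π (fun y b => M.ν₀ y * π y b) t x a * M.p x a y := by
    simp only [stateDist, saDist, ← Finset.mul_sum, (hπ y).2, mul_one]
  rw [this]
  refine Finset.sum_congr rfl fun x _ => ?_
  rw [Finset.sum_mul]
  exact Finset.sum_congr rfl fun a _ => by rw [M.saDist_eq_stateDist_mul hπ]; ring

lemma stateDist_nonneg (hπ : IsPolicy π) (t : ℕ) (x : X) : 0 ≤ M.stateDist π t x :=
  Finset.sum_nonneg fun a _ =>
    M.saDist_nonneg hπ (fun y b => mul_nonneg (M.ν₀_mem.1 y) ((hπ y).1 b)) t x a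

lemma sum_stateDist (hπ : IsPolicy π) (t : ℕ) : ∑ x, M.stateDist π t x = 1 := by
  unfold stateDist
  rw [M.sum_sum_saDist hπ]
  simp only [← Finset.mul_sum, (hπ _).2, mul_one, M.ν₀_mem.2]

lemma abs_stateDist_le_one (hπ : IsPolicy π) (t : ℕ) (x : X) : |M.stateDist π t x| ≤ 1 := by
  rw [abs_of_nonneg (M.stateDist_nonneg hπ t x), ← M.sum_stateDist hπ t]
  exact Finset.single_le_sum (fun y _ => M.stateDist_nonneg hπ t y) (Finset.mem_univ x)

lemma hasSum_stateDist (hγ : 0 ≤ γ) (hγ1 : γ < 1) (hπ : IsPolicy π) (x : X) :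
    HasSum (fun t => γ ^ t * M.stateDist π t x) (∑' t, γ ^ t * M.stateDist π t x) :=
  hasSum_discounted hγ hγ1 fun t => M.abs_stateDist_le_one hπ t x

lemma stateOcc_eq (π : X → A → ℝ) (x : X) :
    M.stateOcc π x = (1 - γ) * ∑' t, γ ^ t * M.stateDist π t x := rfl

lemma stateOcc_nonneg (hγ : 0 ≤ γ) (hγ1 : γ < 1) (hπ : IsPolicy π) (x : X) :
    0 ≤ M.stateOcc π x :=
  mul_nonneg (by linarith) (tsum_nonneg fun t =>
    mul_nonneg (pow_nonneg hγ t) (M.stateDist_nonneg hπ t x))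

lemma sum_stateOcc (hγ : 0 ≤ γ) (hγ1 : γ < 1) (hπ : IsPolicy π) :
    ∑ x, M.stateOcc π x = 1 := by
  simp only [stateOcc_eq, ← Finset.mul_sum]
  have h1 := hasSum_sum (s := Finset.univ) fun x _ => M.hasSum_stateDist hγ hγ1 hπ x
  simp only [← Finset.mul_sum, M.sum_stateDist hπ, mul_one] at h1
  rw [h1.unique (hasSum_geometric_of_lt_one hγ hγ1)]
  exact mul_inv_cancel₀ (by linarith)

/-- The Bellman flow constraint. -/
lemma stateOcc_flow (hγ : 0 ≤ γ) (hγ1 : γ < 1) (hπ : IsPolicy π) (y : X) :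
    M.stateOcc π y = (1 - γ) * M.ν₀ y + γ * ∑ x, ∑ a, M.occ π x a * M.p x a y := by
  have h := discounted_sum_fixed_point (fun x => M.hasSum_stateDist hγ hγ1 hπ x)
    (M.stateDist_succ hπ) y
  rw [stateOcc_eq, h, M.stateDist_zero hπ, mul_add, ← mul_assoc (1 - γ) γ, mul_comm (1 - γ) γ,
    mul_assoc, Finset.mul_sum]
  congr 2
  refine Finset.sum_congr rfl fun x _ => ?_
  rw [Finset.sum_mul, Finset.mul_sum]
  refine Finset.sum_congr rfl fun a _ => ?_
  rw [occ, stateOcc_eq]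
  ring

lemma occ_nonneg (hγ : 0 ≤ γ) (hγ1 : γ < 1) (hπ : IsPolicy π) (x : X) (a : A) :
    0 ≤ M.occ π x a :=
  mul_nonneg ((hπ x).1 a) (M.stateOcc_nonneg hγ hγ1 hπ x)

lemma sum_occ_action (hπ : IsPolicy π) (x : X) : ∑ a, M.occ π x a = M.stateOcc π x := by
  simp only [occ, ← Finset.sum_mul, (hπ x).2, one_mul]

lemma sum_occ (hγ : 0 ≤ γ) (hγ1 : γ < 1) (hπ : IsPolicy π) : ∑ x, ∑ a, M.occ π x a = 1 := by
  simp only [M.sum_occ_action hπ, M.sum_stateOcc hγ hγ1 hπ]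

end Occupancy

section Value

variable (M : LinearMDP X A d γ) {π : X → A → ℝ}

/-- The evolution is linear in the initial law, so it is a mixture of the evolutions from point
masses. -/
lemma saDist_eq_sum_dirac (π μ₀ : X → A → ℝ) (t : ℕ) (y : X) (b : A) :
    M.saDist π μ₀ t y b = ∑ x, ∑ a, μ₀ x a *
      M.saDist π (fun y b => if y = x ∧ b = a then 1 else 0) t y b := by
  induction t generalizing y b with
  | zero =>
    simp only [saDist]
    rw [Finset.sum_eq_single y, Finset.sum_eq_single b] <;> simp +contextual [eq_comm]
  | succ t ih =>
    simp only [saDist]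
    have : ∀ z c, M.saDist π μ₀ t z c * M.p z c y = ∑ x, ∑ a, μ₀ x a *
        (M.saDist π (fun y b => if y = x ∧ b = a then 1 else 0) t z c * M.p z c y) := by
      intro z c
      rw [ih, Finset.sum_mul]
      refine Finset.sum_congr rfl fun x _ => ?_
      rw [Finset.sum_mul]
      exact Finset.sum_congr rfl fun a _ => by ring
    simp only [this]
    rw [Finset.sum_congr rfl fun z _ => Finset.sum_comm, Finset.sum_comm, Finset.sum_mul]
    refine Finset.sum_congr rfl fun x _ => ?_
    rw [Finset.sum_congr rfl fun z _ => Finset.sum_comm, Finset.sum_comm, Finset.sum_mul]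
    refine Finset.sum_congr rfl fun a _ => ?_
    simp only [← Finset.mul_sum]
    ring

/-- The recursion defining `saDist` splits off the last transition; the Bellman equation needs the
first one split off. -/
lemma saDist_succ' (π μ₀ : X → A → ℝ) (t : ℕ) :
    M.saDist π μ₀ (t + 1) = M.saDist π (M.saDist π μ₀ 1) t := by
  induction t with
  | zero => rfl
  | succ t ih =>
    funext y b
    rw [saDist, ih]
    rfl

/-- Expected reward at time `t` when starting from `(x, a)` and following `π`. -/
def rewardAt (π : X → A → ℝ) (t : ℕ) (z : X × A) : ℝ :=
  ∑ y, ∑ b, M.saDist π (fun y b => if y = z.1 ∧ b = z.2 then 1 else 0) t y b * M.r y b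

lemma rewardAt_zero (π : X → A → ℝ) (z : X × A) : M.rewardAt π 0 z = M.r z.1 z.2 := by
  simp only [rewardAt, saDist]
  rw [Finset.sum_eq_single z.1, Finset.sum_eq_single z.2] <;> simp +contextual

lemma rewardAt_succ (π : X → A → ℝ) (t : ℕ) (z : X × A) :
    M.rewardAt π (t + 1) z = ∑ y : X × A, (M.p z.1 z.2 y.1 * π y.1 y.2) * M.rewardAt π t y := by
  have h1 : M.saDist π (fun y b => if y = z.1 ∧ b = z.2 then 1 else 0) 1
      = fun y b => M.p z.1 z.2 y * π y b := by
    funext y b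
    simp only [saDist]
    rw [Finset.sum_eq_single z.1, Finset.sum_eq_single z.2] <;> simp +contextual
  simp only [rewardAt, Fintype.sum_prod_type]
  rw [M.saDist_succ' _ _ t, h1]
  have : ∀ y b, M.saDist π (fun y b => M.p z.1 z.2 y * π y b) t y b * M.r y b
      = ∑ x, ∑ a, M.p z.1 z.2 x * π x a *
        (M.saDist π (fun y b => if y = x ∧ b = a then 1 else 0) t y b * M.r y b) := by
    intro y b
    rw [M.saDist_eq_sum_dirac, Finset.sum_mul]
    refine Finset.sum_congr rfl fun x _ => ?_
    rw [Finset.sum_mul]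
    exact Finset.sum_congr rfl fun a _ => by ring
  simp only [this]
  rw [Finset.sum_congr rfl fun z _ => Finset.sum_comm, Finset.sum_comm]
  refine Finset.sum_congr rfl fun x _ => ?_
  rw [Finset.sum_congr rfl fun z _ => Finset.sum_comm, Finset.sum_comm]
  refine Finset.sum_congr rfl fun a _ => ?_
  simp only [← Finset.mul_sum]

lemma rewardAt_mem (hπ : IsPolicy π) (t : ℕ) (z : X × A) :
    M.rewardAt π t z ∈ Set.Icc (0 : ℝ) 1 := by
  induction t generalizing z with
  | zero => rw [M.rewardAt_zero]; exact M.r_mem _ _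
  | succ t ih =>
    rw [M.rewardAt_succ]
    have h0 : ∀ y : X × A, 0 ≤ M.p z.1 z.2 y.1 * π y.1 y.2 := fun y =>
      mul_nonneg ((M.p_mem _ _).1 _) ((hπ _).1 _)
    refine ⟨Finset.sum_nonneg fun y _ => mul_nonneg (h0 y) (ih y).1, ?_⟩
    calc _ ≤ ∑ y : X × A, M.p z.1 z.2 y.1 * π y.1 y.2 :=
          Finset.sum_le_sum fun y _ => mul_le_of_le_one_right (h0 y) (ih y).2
      _ = 1 := by
          simp only [Fintype.sum_prod_type, ← Finset.mul_sum, (hπ _).2, mul_one, (M.p_mem _ _).2]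

/-- The Bellman equation. -/
lemma qValue_eq (hγ : 0 ≤ γ) (hγ1 : γ < 1) (hπ : IsPolicy π) (x : X) (a : A) :
    M.qValue π x a = M.r x a + γ * ∑ y, M.p x a y * M.vValue π y := by
  have h := discounted_sum_fixed_point (U := fun z : X × A => M.qValue π z.1 z.2)
    (u := M.rewardAt π)
    (fun z => hasSum_discounted hγ hγ1 (C := 1) fun t => by
      rw [abs_of_nonneg (M.rewardAt_mem hπ t z).1]; exact (M.rewardAt_mem hπ t z).2)
    (M.rewardAt_succ π) (x, a)
  simp only [M.rewardAt_zero, Fintype.sum_prod_type] at h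
  rw [h]
  congr 2
  refine Finset.sum_congr rfl fun y _ => ?_
  rw [vValue, Finset.mul_sum]
  exact Finset.sum_congr rfl fun b _ => by ring

/-- Both terms on the right of the Bellman equation are linear in `φ(x,a)` because `r` and `p` are.
-/
lemma inner_thetaOf (hγ : 0 ≤ γ) (hγ1 : γ < 1) (hπ : IsPolicy π) (x : X) (a : A) :
    inner ℝ (M.φ x a) (M.thetaOf π) = M.qValue π x a := by
  rw [M.qValue_eq hγ hγ1 hπ, thetaOf, inner_add_right, real_inner_smul_right, inner_sum,
    ← M.r_eq]
  congr 2
  refine Finset.sum_congr rfl fun y _ => ?_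
  rw [real_inner_smul_right, ← M.p_eq, mul_comm]

/-- The discounted return, in terms of occupancy measure and of value function. -/
lemma sum_occ_mul_r (hγ : 0 ≤ γ) (hγ1 : γ < 1) (hπ : IsPolicy π) :
    ∑ x, ∑ a, M.occ π x a * M.r x a = (1 - γ) * ∑ x, M.ν₀ x * M.vValue π x := by
  -- With `r = q - γPv`, summing against `μ^π` leaves `⟨ν^π, v⟩` minus its discounted flow, which is
  -- `(1-γ)⟨ν₀, v⟩` by `stateOcc_flow`.
  have h1 : ∀ x a, M.occ π x a * M.r x a = M.occ π x a * M.qValue π x a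
      - γ * ∑ y, M.occ π x a * M.p x a y * M.vValue π y := by
    intro x a
    rw [M.qValue_eq hγ hγ1 hπ]
    simp only [mul_assoc, ← Finset.mul_sum]
    ring
  have h2 : ∀ x, ∑ a, M.occ π x a * M.qValue π x a = M.stateOcc π x * M.vValue π x := by
    intro x
    rw [vValue, Finset.mul_sum]
    exact Finset.sum_congr rfl fun a _ => by rw [occ]; ring
  have h3 : ∑ x, ∑ a, ∑ y, M.occ π x a * M.p x a y * M.vValue π y
      = ∑ y, (∑ x, ∑ a, M.occ π x a * M.p x a y) * M.vValue π y := by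
    rw [Finset.sum_congr rfl fun z _ => Finset.sum_comm, Finset.sum_comm]
    simp only [Finset.sum_mul]
  simp only [h1, Finset.sum_sub_distrib, ← Finset.mul_sum, h2, h3]
  rw [Finset.mul_sum, Finset.mul_sum, ← Finset.sum_sub_distrib]
  refine Finset.sum_congr rfl fun y _ => ?_
  rw [M.stateOcc_flow hγ hγ1 hπ]
  ring

end Value

end LinearMDP

/-! ### Real powers of a positive definite matrix. -/

section MatrixPower

variable {d : ℕ} {S : Matrix (Fin d) (Fin d) ℝ}

lemma matPow_isHermitian (S : Matrix (Fin d) (Fin d) ℝ) (s : ℝ) : (matPow S s).IsHermitian :=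
  cfc_predicate (p := IsSelfAdjoint) _ S

/-- Positive definiteness keeps the spectrum away from `0`, the only point where `x ^ s` can fail to
be continuous; without continuity the functional calculus would return a junk value. -/
lemma continuousOn_rpow_spectrum (hS : S.PosDef) (s : ℝ) :
    ContinuousOn (fun x : ℝ => x ^ s) (spectrum ℝ S) := by
  intro x hx
  rw [hS.isHermitian.spectrum_real_eq_range_eigenvalues] at hx
  obtain ⟨i, rfl⟩ := hx
  exact (Real.continuousAt_rpow_const _ _ (Or.inl (hS.eigenvalues_pos i).ne')).continuousWithinAt

lemma matPow_mul_matPow (hS : S.PosDef) (s t : ℝ) :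
    matPow S s * matPow S t = matPow S (s + t) := by
  rw [matPow, matPow, matPow, ← cfc_mul _ _ S (continuousOn_rpow_spectrum hS s)
    (continuousOn_rpow_spectrum hS t)]
  refine cfc_congr fun x hx => ?_
  rw [hS.isHermitian.spectrum_real_eq_range_eigenvalues] at hx
  obtain ⟨i, rfl⟩ := hx
  exact (Real.rpow_add (hS.eigenvalues_pos i) s t).symm

lemma matPow_zero (hS : S.PosDef) : matPow S 0 = 1 := by
  simp only [matPow, Real.rpow_zero]
  exact cfc_const_one ℝ S hS.isHermitian

lemma matPow_one (hS : S.PosDef) : matPow S 1 = S := by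
  simp only [matPow, Real.rpow_one]
  exact cfc_id' ℝ S hS.isHermitian

lemma mulV_mul (S T : Matrix (Fin d) (Fin d) ℝ) (v : Vec d) :
    mulV (S * T) v = mulV S (mulV T v) := by
  simp [mulV, Matrix.toLpLin_apply]

lemma mulV_one (v : Vec d) : mulV 1 v = v := by
  simp [mulV]

lemma mulV_sub (S : Matrix (Fin d) (Fin d) ℝ) (u v : Vec d) :
    mulV S (u - v) = mulV S u - mulV S v := map_sub _ _ _

lemma inner_mulV_left (hS : S.IsHermitian) (u v : Vec d) :
    inner ℝ (mulV S u) v = inner ℝ u (mulV S v) :=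
  Matrix.isSymmetric_toEuclideanLin_iff.2 hS u v

lemma inner_matPow_left (S : Matrix (Fin d) (Fin d) ℝ) (s : ℝ) (u v : Vec d) :
    inner ℝ (mulV (matPow S s) u) v = inner ℝ u (mulV (matPow S s) v) :=
  inner_mulV_left (matPow_isHermitian S s) u v

lemma mulV_matPow_matPow (hS : S.PosDef) (s t : ℝ) (v : Vec d) :
    mulV (matPow S s) (mulV (matPow S t) v) = mulV (matPow S (s + t)) v := by
  rw [← mulV_mul, matPow_mul_matPow hS]

end MatrixPower

/-! ### Projection onto a ball. -/

section Projection

variable {d : ℕ}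

lemma norm_projBall_le {D : ℝ} (hD : 0 ≤ D) (y : Vec d) : ‖projBall D y‖ ≤ D := by
  unfold projBall
  split_ifs with h
  · exact h
  · have hy : 0 < ‖y‖ := hD.trans_lt (not_le.1 h)
    rw [norm_smul, Real.norm_eq_abs, abs_of_nonneg (div_nonneg hD hy.le), div_mul_cancel₀ _ hy.ne']

/-- When `‖y‖ > D`, expanding both squares and using `⟨y, z⟩ ≤ ‖y‖ D` shows that the squared
distance drops by at least `(‖y‖ - D)²`. -/
lemma norm_projBall_sub_le {D : ℝ} (y : Vec d) {z : Vec d} (hz : ‖z‖ ≤ D) :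
    ‖projBall D y - z‖ ^ 2 ≤ ‖y - z‖ ^ 2 := by
  unfold projBall
  split_ifs with h
  · exact le_rfl
  · have hD : 0 ≤ D := (norm_nonneg z).trans hz
    push Not at h
    have hy : 0 < ‖y‖ := hD.trans_lt h
    rw [norm_sub_sq_real, norm_sub_sq_real, norm_smul, real_inner_smul_left, Real.norm_eq_abs,
      abs_of_nonneg (div_nonneg hD hy.le), div_mul_cancel₀ _ hy.ne']
    have h1 : inner ℝ y z ≤ ‖y‖ * D :=
      (real_inner_le_norm y z).trans (mul_le_mul_of_nonneg_left hz hy.le)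
    have h2 : 0 ≤ 1 - D / ‖y‖ := by rw [sub_nonneg, div_le_one hy]; exact h.le
    have h3 : (1 - D / ‖y‖) * inner ℝ y z ≤ (1 - D / ‖y‖) * (‖y‖ * D) :=
      mul_le_mul_of_nonneg_left h1 h2
    have h4 : (1 - D / ‖y‖) * (‖y‖ * D) = ‖y‖ * D - D ^ 2 := by field_simp
    nlinarith [sq_nonneg (‖y‖ - D)]

end Projection

/-! ### Exponential weights. -/

section Softmax

/-- One step of exponential weights: the increase of the log-partition function is at most the
mean increment plus a quadratic error. -/
lemma log_sum_exp_add_le {A : Type*} [Fintype A] [Nonempty A] (f g : A → ℝ) {b : ℝ} (hb : b ≤ 1)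
    (hg : ∀ a, |g a| ≤ b) :
    Real.log (∑ a, Real.exp (f a + g a)) ≤ Real.log (∑ a, Real.exp (f a)) +
      ∑ a, (Real.exp (f a) / ∑ a', Real.exp (f a')) * g a + b ^ 2 := by
  set Z := ∑ a, Real.exp (f a) with hZ
  have hZ0 : 0 < Z := Finset.sum_pos (fun a _ => Real.exp_pos _) Finset.univ_nonempty
  set m := ∑ a, (Real.exp (f a) / Z) * g a with hm
  have h1 : ∑ a, Real.exp (f a + g a) ≤ Z * (1 + (m + b ^ 2)) := by
    have : ∀ a, Real.exp (f a + g a) ≤ Real.exp (f a) * (1 + g a + b ^ 2) := by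
      intro a
      rw [Real.exp_add]
      refine mul_le_mul_of_nonneg_left ?_ (Real.exp_pos _).le
      -- This is `e^g ≤ 1 + g + g²`, valid for `|g| ≤ 1`; it is the reason for the hypothesis `b ≤
      -- 1`.
      have h2 := (abs_le.1 (Real.abs_exp_sub_one_sub_id_le ((hg a).trans hb))).2
      have h3 : g a ^ 2 ≤ b ^ 2 := sq_le_sq' (abs_le.1 (hg a)).1 (abs_le.1 (hg a)).2
      linarith
    refine (Finset.sum_le_sum fun a _ => this a).trans (le_of_eq ?_)
    have h4 : Z * m = ∑ a, Real.exp (f a) * g a := by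
      rw [hm, Finset.mul_sum]
      exact Finset.sum_congr rfl fun a _ => by field_simp
    rw [mul_add, mul_add, h4]
    simp only [mul_add, Finset.sum_add_distrib, mul_one, ← Finset.sum_mul, ← hZ]
    ring
  have h2 : ∑ a, Real.exp (f a + g a) ≤ Z * Real.exp (m + b ^ 2) :=
    h1.trans (mul_le_mul_of_nonneg_left (by linarith [Real.add_one_le_exp (m + b ^ 2)]) hZ0.le)
  calc _ ≤ Real.log (Z * Real.exp (m + b ^ 2)) :=
        Real.log_le_log (Finset.sum_pos (fun a _ => Real.exp_pos _) Finset.univ_nonempty) h2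
    _ = _ := by rw [Real.log_mul hZ0.ne' (Real.exp_pos _).ne', Real.log_exp]; ring

lemma le_log_sum_exp {A : Type*} [Fintype A] (f : A → ℝ) (a : A) :
    f a ≤ Real.log (∑ a, Real.exp (f a)) := by
  refine (Real.log_exp (f a)).symm.le.trans ?_
  exact Real.log_le_log (Real.exp_pos _)
    (Finset.single_le_sum (f := fun i => Real.exp (f i)) (fun i _ => (Real.exp_pos _).le)
      (Finset.mem_univ a))

variable {X A : Type*} [Fintype X] [Fintype A] [DecidableEq X] [DecidableEq A]
  {d : ℕ} {γ : ℝ}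

lemma LinearMDP.softmax_isPolicy [Nonempty A] (M : LinearMDP X A d γ) (α : ℝ) (S : Vec d) :
    IsPolicy (M.softmax α S) := by
  intro x
  have hZ0 : 0 < ∑ b, Real.exp (α * inner ℝ (M.φ x b) S) :=
    Finset.sum_pos (fun a _ => Real.exp_pos _) Finset.univ_nonempty
  refine ⟨fun a => div_nonneg (Real.exp_pos _).le hZ0.le, ?_⟩
  simp only [LinearMDP.softmax, ← Finset.sum_div]
  exact div_self hZ0.ne'

end Softmax

/-! ### The feature covariance matrix. -/

namespace LinearMDP

variable {X A : Type*} [Fintype X] [Fintype A] [DecidableEq X] [DecidableEq A]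
  {d : ℕ} {γ : ℝ} (M : LinearMDP X A d γ) {πB : X → A → ℝ}

lemma mulV_cov (πB : X → A → ℝ) (v : Vec d) :
    mulV (M.cov πB) v = ∑ x, ∑ a, (M.occ πB x a * inner ℝ (M.φ x a) v) • M.φ x a := by
  ext i
  simp only [mulV, Matrix.toLpLin_apply, Matrix.mulVec, dotProduct, cov, Matrix.of_apply,
    WithLp.ofLp_sum, Finset.sum_apply, WithLp.ofLp_smul, Pi.smul_apply, smul_eq_mul,
    PiLp.inner_apply, RCLike.inner_apply, conj_trivial, Finset.sum_mul, Finset.mul_sum]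
  rw [Finset.sum_comm]
  refine Finset.sum_congr rfl fun x _ => ?_
  rw [Finset.sum_comm]
  exact Finset.sum_congr rfl fun a _ => Finset.sum_congr rfl fun j _ => by ring

lemma inner_mulV_cov (πB : X → A → ℝ) (u v : Vec d) :
    inner ℝ u (mulV (M.cov πB) v)
      = ∑ x, ∑ a, M.occ πB x a * (inner ℝ (M.φ x a) u * inner ℝ (M.φ x a) v) := by
  simp only [mulV_cov, inner_sum, real_inner_smul_right]
  refine Finset.sum_congr rfl fun x _ => Finset.sum_congr rfl fun a _ => ?_
  rw [real_inner_comm (M.φ x a) u]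
  ring

lemma cov_posSemidef (hγ : 0 ≤ γ) (hγ1 : γ < 1) (hπB : IsPolicy πB) :
    (M.cov πB).PosSemidef := by
  have hH : (M.cov πB).IsHermitian := by
    ext i j
    simp only [Matrix.conjTranspose_apply, cov, Matrix.of_apply, star_trivial]
    exact Finset.sum_congr rfl fun x _ => Finset.sum_congr rfl fun a _ => by ring
  refine Matrix.isPositive_toEuclideanLin_iff.1
    ⟨Matrix.isSymmetric_toEuclideanLin_iff.2 hH, fun v => ?_⟩
  change 0 ≤ inner ℝ (mulV (M.cov πB) v) v
  rw [real_inner_comm, inner_mulV_cov]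
  exact Finset.sum_nonneg fun x _ => Finset.sum_nonneg fun a _ =>
    mul_nonneg (M.occ_nonneg hγ hγ1 hπB x a) (mul_self_nonneg _)

lemma cov_posDef (hγ : 0 ≤ γ) (hγ1 : γ < 1) (hπB : IsPolicy πB) (hu : IsUnit (M.cov πB)) :
    (M.cov πB).PosDef :=
  (M.cov_posSemidef hγ hγ1 hπB).posDef_iff_isUnit.2 hu

/-- Taken at `R = Λ⁻¹`, this is where the dimension enters: the trace is then `d`. -/
lemma sum_occ_inner_mulV (πB : X → A → ℝ) (R : Matrix (Fin d) (Fin d) ℝ) :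
    ∑ x, ∑ a, M.occ πB x a * inner ℝ (M.φ x a) (mulV R (M.φ x a))
      = (R * M.cov πB).trace := by
  have h1 : ∀ x a, M.occ πB x a * inner ℝ (M.φ x a) (mulV R (M.φ x a))
      = ∑ i, ∑ j, R i j * (M.occ πB x a * (M.φ x a j * M.φ x a i)) := by
    intro x a
    simp only [mulV, Matrix.toLpLin_apply, Matrix.mulVec, dotProduct, PiLp.inner_apply,
      RCLike.inner_apply, conj_trivial, Finset.sum_mul, Finset.mul_sum]
    exact Finset.sum_congr rfl fun i _ => Finset.sum_congr rfl fun j _ => by ring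
  simp only [h1, ← Fintype.sum_prod_type', Matrix.trace, Matrix.diag, Matrix.mul_apply, cov,
    Matrix.of_apply, Finset.mul_sum]
  exact Fintype.sum_equiv ⟨fun z => (z.2.2.1, z.2.2.2, z.1, z.2.1),
    fun z => (z.2.2.1, z.2.2.2, z.1, z.2.1), fun _ => rfl, fun _ => rfl⟩ _ _ fun _ => rfl

end LinearMDP

/-! ### Expectations over one observation, the regret decomposition and unbiased gradients. -/

section Observations

variable {X A : Type*} [Fintype X] [Fintype A] [DecidableEq X] [DecidableEq A]
  {d : ℕ} {γ : ℝ}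

/-- An observation is a tuple. -/
def obsEquiv (X A : Type*) : (X × X × A × X) ≃ Obs X A where
  toFun z := ⟨z.1, z.2.1, z.2.2.1, z.2.2.2⟩
  invFun o := (o.x₀, o.x, o.a, o.x')
  left_inv _ := rfl
  right_inv _ := rfl

instance : Fintype (Obs X A) := Fintype.ofEquiv _ (obsEquiv X A)

instance : DiscreteMeasurableSpace (Obs X A) := ⟨fun _ => trivial⟩

lemma sum_obs (f : Obs X A → ℝ) :
    ∑ o, f o = ∑ x₀, ∑ x, ∑ a, ∑ x', f ⟨x₀, x, a, x'⟩ := by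
  rw [← (obsEquiv X A).sum_comp]
  simp only [Fintype.sum_prod_type]
  rfl

namespace LinearMDP

variable (M : LinearMDP X A d γ) {πB π : X → A → ℝ}

lemma obsProb_nonneg (hγ : 0 ≤ γ) (hγ1 : γ < 1) (hπB : IsPolicy πB) (o : Obs X A) :
    0 ≤ M.obsProb πB o :=
  mul_nonneg (mul_nonneg (M.ν₀_mem.1 _) (M.occ_nonneg hγ hγ1 hπB _ _)) ((M.p_mem _ _).1 _)

lemma sum_obsProb_mul_transition (πB : X → A → ℝ) (f : X → A → X → ℝ) :
    ∑ o, M.obsProb πB o * f o.x o.a o.x'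
      = ∑ x, ∑ a, M.occ πB x a * ∑ x', M.p x a x' * f x a x' := by
  simp only [sum_obs, obsProb, mul_assoc, ← Finset.mul_sum]
  rw [← Finset.sum_mul, M.ν₀_mem.2, one_mul]

lemma sum_obsProb_mul_pair (πB : X → A → ℝ) (f : X → A → ℝ) :
    ∑ o, M.obsProb πB o * f o.x o.a = ∑ x, ∑ a, M.occ πB x a * f x a := by
  rw [M.sum_obsProb_mul_transition πB fun x a _ => f x a]
  simp only [← Finset.sum_mul, (M.p_mem _ _).2, one_mul]

lemma sum_obsProb_mul_init (hγ : 0 ≤ γ) (hγ1 : γ < 1) (hπB : IsPolicy πB) (f : X → ℝ) :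
    ∑ o, M.obsProb πB o * f o.x₀ = ∑ x, M.ν₀ x * f x := by
  simp only [sum_obs, obsProb]
  refine Finset.sum_congr rfl fun x _ => ?_
  simp only [← Finset.sum_mul, ← Finset.mul_sum, (M.p_mem _ _).2, mul_one,
    M.sum_occ hγ hγ1 hπB]

lemma sum_obsProb (hγ : 0 ≤ γ) (hγ1 : γ < 1) (hπB : IsPolicy πB) :
    ∑ o, M.obsProb πB o = 1 := by
  simpa [M.ν₀_mem.2] using M.sum_obsProb_mul_init hγ hγ1 hπB fun _ => 1

/-- The value function induced by the parameter `θ` and the policy `π`. -/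
def vAt (π : X → A → ℝ) (θ : Vec d) (x : X) : ℝ := ∑ a, π x a * inner ℝ (M.φ x a) θ

lemma vAt_sub (π : X → A → ℝ) (θ θ' : Vec d) (x : X) :
    M.vAt π (θ - θ') x = M.vAt π θ x - M.vAt π θ' x := by
  simp only [vAt, inner_sub_right, mul_sub, Finset.sum_sub_distrib]

lemma vAt_thetaOf (hγ : 0 ≤ γ) (hγ1 : γ < 1) (hπ : IsPolicy π) (x : X) :
    M.vAt π (M.thetaOf π) x = M.vValue π x := by
  simp only [vAt, vValue, M.inner_thetaOf hγ hγ1 hπ]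

/-- The mean feature vector of `π` in state `x`. -/
def phiAt (π : X → A → ℝ) (x : X) : Vec d := ∑ a, π x a • M.φ x a

lemma inner_phiAt (π : X → A → ℝ) (x : X) (u : Vec d) :
    inner ℝ (M.phiAt π x) u = M.vAt π u x := by
  simp only [phiAt, vAt, sum_inner, real_inner_smul_left]

lemma norm_phiAt_le (hπ : IsPolicy π) {b : ℝ} (hb : ∀ x a, ‖M.φ x a‖ ≤ b) (x : X) :
    ‖M.phiAt π x‖ ≤ b := by
  calc _ ≤ ∑ a, π x a * b := (norm_sum_le _ _).trans (Finset.sum_le_sum fun a _ => by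
        rw [norm_smul, Real.norm_eq_abs, abs_of_nonneg ((hπ x).1 a)]
        exact mul_le_mul_of_nonneg_left (hb x a) ((hπ x).1 a))
    _ = b := by rw [← Finset.sum_mul, (hπ x).2, one_mul]

/-- The residual `ω + γ Ψ v - θ` of the Bellman equation. -/
def bellmanErr (π : X → A → ℝ) (θ : Vec d) : Vec d :=
  M.ω + γ • ∑ x, M.vAt π θ x • M.ψ x - θ

/-- Derivative in direction `u` of the Lagrangian with respect to `θ`, where `l` is the feature
occupancy vector. -/
def lagrangianDeriv (π : X → A → ℝ) (l u : Vec d) : ℝ :=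
  (1 - γ) * ∑ x, M.ν₀ x * M.vAt π u x + inner ℝ l (γ • ∑ x, M.vAt π u x • M.ψ x - u)

lemma bellmanErr_thetaOf (hγ : 0 ≤ γ) (hγ1 : γ < 1) (hπ : IsPolicy π) :
    M.bellmanErr π (M.thetaOf π) = 0 := by
  simp only [bellmanErr, M.vAt_thetaOf hγ hγ1 hπ]
  exact sub_self _

/-- The Lagrangian is affine in `θ`, so its derivative in direction `θ - θ^π` is an exact difference
of values. The value at `θ^π` is the return of `π`, independently of `l`. -/
lemma lagrangianDeriv_sub_thetaOf (hγ : 0 ≤ γ) (hγ1 : γ < 1) (hπ : IsPolicy π) (l θ : Vec d) :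
    M.lagrangianDeriv π l (θ - M.thetaOf π)
      = (1 - γ) * ∑ x, M.ν₀ x * M.vAt π θ x + inner ℝ l (M.bellmanErr π θ)
        - ∑ x, ∑ a, M.occ π x a * M.r x a := by
  have h : γ • ∑ x, M.vAt π (θ - M.thetaOf π) x • M.ψ x - (θ - M.thetaOf π)
      = M.bellmanErr π θ - M.bellmanErr π (M.thetaOf π) := by
    simp only [bellmanErr, vAt_sub, sub_smul, Finset.sum_sub_distrib, smul_sub]
    abel
  rw [lagrangianDeriv, h, M.bellmanErr_thetaOf hγ hγ1 hπ, sub_zero, M.sum_occ_mul_r hγ hγ1 hπ]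
  simp only [vAt_sub, M.vAt_thetaOf hγ hγ1 hπ, mul_sub, Finset.sum_sub_distrib]
  ring

lemma inner_meanFeature (π : X → A → ℝ) (u : Vec d) :
    inner ℝ (M.meanFeature π) u = ∑ x, ∑ a, M.occ π x a * inner ℝ (M.φ x a) u := by
  simp only [meanFeature, sum_inner, real_inner_smul_left]

lemma inner_meanFeature_bellmanErr (hγ : 0 ≤ γ) (hγ1 : γ < 1) {πs : X → A → ℝ}
    (hπs : IsPolicy πs) (π : X → A → ℝ) (θ : Vec d) :
    inner ℝ (M.meanFeature πs) (M.bellmanErr π θ)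
      = ∑ x, ∑ a, M.occ πs x a * M.r x a + ∑ x, M.stateOcc πs x * M.vAt π θ x
        - (1 - γ) * ∑ x, M.ν₀ x * M.vAt π θ x - inner ℝ (M.meanFeature πs) θ := by
  have h1 : inner ℝ (M.meanFeature πs) M.ω = ∑ x, ∑ a, M.occ πs x a * M.r x a := by
    simp only [inner_meanFeature, M.r_eq]
  -- The flow constraint of `πs` in feature form: `Ψᵀ E_{μ^{πs}}[φ]` is the law of the next state.
  have h2 : ∀ y, γ * inner ℝ (M.meanFeature πs) (M.ψ y)
      = M.stateOcc πs y - (1 - γ) * M.ν₀ y := by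
    intro y
    rw [M.stateOcc_flow hγ hγ1 hπs y, inner_meanFeature]
    simp only [M.p_eq]
    ring
  rw [bellmanErr, inner_sub_right, inner_add_right, h1, real_inner_smul_right, inner_sum,
    Finset.mul_sum, Finset.mul_sum]
  have h3 : ∑ x, γ * inner ℝ (M.meanFeature πs) (M.vAt π θ x • M.ψ x)
      = ∑ x, M.stateOcc πs x * M.vAt π θ x - ∑ x, (1 - γ) * (M.ν₀ x * M.vAt π θ x) := by
    rw [← Finset.sum_sub_distrib]
    refine Finset.sum_congr rfl fun x _ => ?_
    rw [real_inner_smul_right]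
    linear_combination M.vAt π θ x * h2 x
  rw [h3]
  ring

/-- Decomposition of the suboptimality of `π` against `πs` into the regrets of the three
players. -/
lemma suboptimality_eq (hγ : 0 ≤ γ) (hγ1 : γ < 1) {πs : X → A → ℝ} (hπs : IsPolicy πs)
    (hπ : IsPolicy π) (l θ : Vec d) :
    ∑ x, ∑ a, (M.occ πs x a - M.occ π x a) * M.r x a
      = (inner ℝ (M.meanFeature πs) θ - ∑ x, M.stateOcc πs x * M.vAt π θ x)
        + inner ℝ (M.meanFeature πs - l) (M.bellmanErr π θ)
        + M.lagrangianDeriv π l (θ - M.thetaOf π) := by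
  rw [M.lagrangianDeriv_sub_thetaOf hγ hγ1 hπ, inner_sub_left,
    M.inner_meanFeature_bellmanErr hγ hγ1 hπs]
  simp only [sub_mul, Finset.sum_sub_distrib]
  ring

/-- The feature occupancy vector `Λ^c β`. -/
def featOcc (πB : X → A → ℝ) (c : ℝ) (β : Vec d) : Vec d :=
  mulV (M.cov πB) (mulV (matPow (M.cov πB) (c - 1)) β)

lemma sum_muEst_smul (πB π : X → A → ℝ) (c : ℝ) (β : Vec d) (o : Obs X A) :
    ∑ x, ∑ a, M.muEst πB c π β o x a • M.φ x a = (1 - γ) • M.phiAt π o.x₀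
      + (γ * inner ℝ (M.φ o.x o.a) (mulV (matPow (M.cov πB) (c - 1)) β)) • M.phiAt π o.x' := by
  have h : ∀ x, ∑ a, M.muEst πB c π β o x a • M.φ x a
      = ((1 - γ) * (if o.x₀ = x then 1 else 0) +
        γ * inner ℝ (M.φ o.x o.a) (mulV (matPow (M.cov πB) (c - 1)) β) *
          (if o.x' = x then 1 else 0)) • M.phiAt π x := by
    intro x
    rw [phiAt, Finset.smul_sum]
    refine Finset.sum_congr rfl fun a _ => ?_
    rw [smul_smul, muEst, mul_comm]
  simp only [h, add_smul, Finset.sum_add_distrib]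
  congr 1 <;> simp

lemma inner_gTheta (πB π : X → A → ℝ) (c : ℝ) (β u : Vec d) (o : Obs X A) :
    inner ℝ (M.gTheta πB c π β o) u = (1 - γ) * M.vAt π u o.x₀
      + inner ℝ (M.φ o.x o.a) (mulV (matPow (M.cov πB) (c - 1)) β) *
        (γ * M.vAt π u o.x' - inner ℝ (M.φ o.x o.a) u) := by
  rw [gTheta, sum_muEst_smul, inner_sub_left, inner_add_left]
  simp only [real_inner_smul_left, inner_phiAt]
  ring

lemma sum_p_mul (w : X → ℝ) (x : X) (a : A) :
    ∑ x', M.p x a x' * w x' = inner ℝ (M.φ x a) (∑ x', w x' • M.ψ x') := by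
  rw [inner_sum]
  refine Finset.sum_congr rfl fun y _ => ?_
  rw [real_inner_smul_right, M.p_eq, mul_comm]

/-- The gradient for `θ` is unbiased: averaging the weight `⟨φ, Λ^{c-1}β⟩` against `φ` under `μ_B`
gives `Λ^c β`, and linearity of the transitions replaces `X'` by `Ψ`. -/
lemma sum_obsProb_mul_inner_gTheta (hγ : 0 ≤ γ) (hγ1 : γ < 1) (hπB : IsPolicy πB)
    (π : X → A → ℝ) (c : ℝ) (β u : Vec d) :
    ∑ o, M.obsProb πB o * inner ℝ (M.gTheta πB c π β o) u
      = M.lagrangianDeriv π (M.featOcc πB c β) u := by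
  simp only [inner_gTheta, mul_add, Finset.sum_add_distrib]
  rw [M.sum_obsProb_mul_init hγ hγ1 hπB fun x => (1 - γ) * M.vAt π u x,
    M.sum_obsProb_mul_transition πB fun x a x' =>
      inner ℝ (M.φ x a) (mulV (matPow (M.cov πB) (c - 1)) β) *
        (γ * M.vAt π u x' - inner ℝ (M.φ x a) u)]
  rw [lagrangianDeriv, real_inner_comm, featOcc, inner_mulV_cov, Finset.mul_sum]
  congr 1
  · exact Finset.sum_congr rfl fun x _ => by ring
  · refine Finset.sum_congr rfl fun x _ => Finset.sum_congr rfl fun a _ => ?_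
    congr 1
    rw [inner_sub_right, real_inner_smul_right, ← sum_p_mul]
    have h1 := (M.p_mem x a).2
    have : ∀ x', M.p x a x' * (inner ℝ (M.φ x a) (mulV (matPow (M.cov πB) (c - 1)) β) *
        (γ * M.vAt π u x' - inner ℝ (M.φ x a) u))
        = inner ℝ (M.φ x a) (mulV (matPow (M.cov πB) (c - 1)) β) *
          (γ * (M.p x a x' * M.vAt π u x')) - inner ℝ (M.φ x a)
            (mulV (matPow (M.cov πB) (c - 1)) β) * inner ℝ (M.φ x a) u * M.p x a x' := by
      intro x'; ring
    simp only [this, Finset.sum_sub_distrib, ← Finset.mul_sum, h1]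
    ring

/-- The gradient for `β` is unbiased: the temporal difference has conditional mean `⟨φ, ω + γΨv -
θ⟩`, and the remaining average over `φφᵀ` produces `Λ`. -/
lemma sum_obsProb_mul_inner_gBeta (πB π : X → A → ℝ) (c : ℝ) (θ w : Vec d) :
    ∑ o, M.obsProb πB o * inner ℝ (M.gBeta πB c π θ o) w
      = inner ℝ (M.featOcc πB c w) (M.bellmanErr π θ) := by
  simp only [gBeta, real_inner_smul_left, inner_matPow_left]
  refine (M.sum_obsProb_mul_transition πB fun x a x' =>
      (M.r x a + γ * M.vAt π θ x' - inner ℝ (M.φ x a) θ) *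
        inner ℝ (M.φ x a) (mulV (matPow (M.cov πB) (c - 1)) w)).trans ?_
  rw [real_inner_comm, featOcc, inner_mulV_cov]
  refine Finset.sum_congr rfl fun x _ => Finset.sum_congr rfl fun a _ => ?_
  congr 1
  rw [bellmanErr, inner_sub_right, inner_add_right, real_inner_smul_right, ← sum_p_mul, ← M.r_eq]
  have h1 := (M.p_mem x a).2
  have : ∀ x', M.p x a x' * ((M.r x a + γ * M.vAt π θ x' - inner ℝ (M.φ x a) θ) *
      inner ℝ (M.φ x a) (mulV (matPow (M.cov πB) (c - 1)) w))
      = inner ℝ (M.φ x a) (mulV (matPow (M.cov πB) (c - 1)) w) *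
        (γ * (M.p x a x' * M.vAt π θ x')) + inner ℝ (M.φ x a)
          (mulV (matPow (M.cov πB) (c - 1)) w) * (M.r x a - inner ℝ (M.φ x a) θ) *
            M.p x a x' := by
    intro x'; ring
  simp only [this, Finset.sum_add_distrib, ← Finset.mul_sum, h1]
  ring

end LinearMDP

end Observations

/-! ### Second moments of the gradients and a lower bound on the coverage ratio. -/

namespace LinearMDP

variable {X A : Type*} [Fintype X] [Fintype A] [DecidableEq X] [DecidableEq A]
  {d : ℕ} {γ : ℝ} (M : LinearMDP X A d γ) {πB π πs : X → A → ℝ} {b c : ℝ}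

/-- The comparator `Λ^{-c} E_{μ^π}[φ]` of the dual player. -/
def betaStar (πB : X → A → ℝ) (c : ℝ) (π : X → A → ℝ) : Vec d :=
  mulV (matPow (M.cov πB) (-c)) (M.meanFeature π)

lemma featOcc_sub (πB : X → A → ℝ) (c : ℝ) (u v : Vec d) :
    M.featOcc πB c (u - v) = M.featOcc πB c u - M.featOcc πB c v := by
  simp only [featOcc, mulV_sub]

lemma featOcc_eq (hS : (M.cov πB).PosDef) (β : Vec d) :
    M.featOcc πB c β = mulV (matPow (M.cov πB) c) β := by
  have h := mulV_matPow_matPow hS 1 (c - 1) β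
  rwa [matPow_one hS, add_sub_cancel] at h

lemma featOcc_betaStar (hS : (M.cov πB).PosDef) (π : X → A → ℝ) :
    M.featOcc πB c (M.betaStar πB c π) = M.meanFeature π := by
  rw [M.featOcc_eq hS, betaStar, mulV_matPow_matPow hS, add_neg_cancel, matPow_zero hS, mulV_one]

lemma norm_betaStar_sq (hS : (M.cov πB).PosDef) (π : X → A → ℝ) :
    ‖M.betaStar πB c π‖ ^ 2 = M.coverage c π πB := by
  rw [← real_inner_self_eq_norm_sq, betaStar, inner_matPow_left, mulV_matPow_matPow hS, coverage,
    two_mul, neg_add]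

lemma sum_occ_mul_inner_sq_le (hγ : 0 ≤ γ) (hγ1 : γ < 1) (hπ : IsPolicy π)
    (hφ : ∀ x a, ‖M.φ x a‖ ≤ b) (u : Vec d) :
    ∑ x, ∑ a, M.occ π x a * inner ℝ (M.φ x a) u ^ 2 ≤ b ^ 2 * ‖u‖ ^ 2 := by
  calc _ ≤ ∑ x, ∑ a, M.occ π x a * (b ^ 2 * ‖u‖ ^ 2) := by
        refine Finset.sum_le_sum fun x _ => Finset.sum_le_sum fun a _ =>
          mul_le_mul_of_nonneg_left ?_ (M.occ_nonneg hγ hγ1 hπ x a)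
        rw [← mul_pow, ← sq_abs]
        exact pow_le_pow_left₀ (abs_nonneg _) ((abs_real_inner_le_norm _ _).trans
          (mul_le_mul_of_nonneg_right (hφ x a) (norm_nonneg u))) 2
    _ = _ := by simp only [← Finset.sum_mul, M.sum_occ hγ hγ1 hπ, one_mul]

/-- Second moment of the importance weight `⟨φ, Λ^{c-1} β⟩`. -/
lemma sum_occ_mul_weight_sq_le (hγ : 0 ≤ γ) (hγ1 : γ < 1) (hπB : IsPolicy πB)
    (hS : (M.cov πB).PosDef) (hc : c = 1 / 2 ∨ c = 1) (hb1 : 1 ≤ b)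
    (hφ : ∀ x a, ‖M.φ x a‖ ≤ b) (β : Vec d) :
    ∑ x, ∑ a, M.occ πB x a * inner ℝ (M.φ x a) (mulV (matPow (M.cov πB) (c - 1)) β) ^ 2
      ≤ b ^ 2 * ‖β‖ ^ 2 := by
  rcases hc with rfl | rfl
  -- For `c = 1/2` the second moment is `⟨Λ^{-1/2}β, Λ Λ^{-1/2}β⟩`, so `Λ` cancels exactly.
  · have h : ∑ x, ∑ a, M.occ πB x a *
        inner ℝ (M.φ x a) (mulV (matPow (M.cov πB) (1 / 2 - 1)) β) ^ 2 = ‖β‖ ^ 2 := by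
      simp only [sq (inner ℝ _ _), ← inner_mulV_cov]
      change inner ℝ _ (M.featOcc πB (1 / 2) β) = _
      rw [M.featOcc_eq hS, inner_matPow_left, mulV_matPow_matPow hS]
      norm_num [matPow_zero hS, mulV_one]
    rw [h]
    exact le_mul_of_one_le_left (sq_nonneg _) (one_le_pow₀ hb1)
  · rw [sub_self, matPow_zero hS, mulV_one]
    exact M.sum_occ_mul_inner_sq_le hγ hγ1 hπB hφ β

/-- Second moment of `Λ^{c-1} φ`. -/
lemma sum_occ_mul_norm_sq_le (hγ : 0 ≤ γ) (hγ1 : γ < 1) (hπB : IsPolicy πB)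
    (hS : (M.cov πB).PosDef) (hc : c = 1 / 2 ∨ c = 1) (hb1 : 1 ≤ b)
    (hφ : ∀ x a, ‖M.φ x a‖ ≤ b) :
    ∑ x, ∑ a, M.occ πB x a * ‖mulV (matPow (M.cov πB) (c - 1)) (M.φ x a)‖ ^ 2
      ≤ b ^ 2 * (d : ℝ) ^ (2 - 2 * c) := by
  rcases hc with rfl | rfl
  -- For `c = 1/2` the sum is `tr(Λ⁻¹Λ) = d`, whereas for `c = 1` no `Λ` is left and `b²` suffices.
  · have h : ∑ x, ∑ a, M.occ πB x a *
        ‖mulV (matPow (M.cov πB) (1 / 2 - 1)) (M.φ x a)‖ ^ 2 = d := by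
      simp only [← real_inner_self_eq_norm_sq, inner_matPow_left, mulV_matPow_matPow hS]
      rw [sum_occ_inner_mulV]
      nth_rewrite 2 [← matPow_one hS]
      rw [matPow_mul_matPow hS]
      norm_num [matPow_zero hS]
    rw [h]
    norm_num
    exact le_mul_of_one_le_left (Nat.cast_nonneg d) (one_le_pow₀ hb1)
  · simp only [sub_self, matPow_zero hS, mulV_one]
    norm_num
    calc _ ≤ ∑ x, ∑ a, M.occ πB x a * b ^ 2 :=
          Finset.sum_le_sum fun x _ => Finset.sum_le_sum fun a _ =>
            mul_le_mul_of_nonneg_left (pow_le_pow_left₀ (norm_nonneg _) (hφ x a) 2)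
              (M.occ_nonneg hγ hγ1 hπB x a)
      _ = _ := by simp only [← Finset.sum_mul, M.sum_occ hγ hγ1 hπB, one_mul]

lemma norm_gTheta_sq_le (hγ : 0 ≤ γ) (hγ1 : γ < 1) (hπ : IsPolicy π)
    (hφ : ∀ x a, ‖M.φ x a‖ ≤ b) (πB : X → A → ℝ) (c : ℝ) (β : Vec d) (o : Obs X A) :
    ‖M.gTheta πB c π β o‖ ^ 2 ≤ 2 * b ^ 2 *
      (1 + 4 * inner ℝ (M.φ o.x o.a) (mulV (matPow (M.cov πB) (c - 1)) β) ^ 2) := by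
  rw [gTheta, sum_muEst_smul]
  set z := inner ℝ (M.φ o.x o.a) (mulV (matPow (M.cov πB) (c - 1)) β)
  have hb : 0 ≤ b := (norm_nonneg _).trans (hφ o.x o.a)
  have h0 : ‖(1 - γ) • M.phiAt π o.x₀‖ ≤ b := by
    rw [norm_smul, Real.norm_eq_abs, abs_of_nonneg (by linarith)]
    nlinarith [M.norm_phiAt_le hπ hφ o.x₀, norm_nonneg (M.phiAt π o.x₀)]
  have h1 : ‖(γ * z) • M.phiAt π o.x'‖ ≤ |z| * b := by
    rw [norm_smul, Real.norm_eq_abs, abs_mul, abs_of_nonneg hγ]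
    exact mul_le_mul (mul_le_of_le_one_left (abs_nonneg z) hγ1.le) (M.norm_phiAt_le hπ hφ o.x')
      (norm_nonneg _) (abs_nonneg z)
  have h2 : ‖z • M.φ o.x o.a‖ ≤ |z| * b := by
    rw [norm_smul, Real.norm_eq_abs]
    exact mul_le_mul_of_nonneg_left (hφ _ _) (abs_nonneg z)
  have h3 : ‖(1 - γ) • M.phiAt π o.x₀ + (γ * z) • M.phiAt π o.x' - z • M.φ o.x o.a‖
      ≤ b * (1 + 2 * |z|) :=
    (norm_sub_le _ _).trans (by
      linarith [norm_add_le ((1 - γ) • M.phiAt π o.x₀) ((γ * z) • M.phiAt π o.x')])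
  refine (pow_le_pow_left₀ (norm_nonneg _) h3 2).trans ?_
  rw [← sq_abs z, mul_pow]
  -- The inequality `(1 + 2|z|)² ≤ 2(1 + 4z²)`, whose two sides differ by `(1 - 2|z|)²`.
  nlinarith [mul_nonneg (sq_nonneg b) (sq_nonneg (1 - 2 * |z|))]

lemma sum_obsProb_mul_norm_gTheta_sq_le (hγ : 0 ≤ γ) (hγ1 : γ < 1) (hπB : IsPolicy πB)
    (hS : (M.cov πB).PosDef) (hc : c = 1 / 2 ∨ c = 1) (hb1 : 1 ≤ b)
    (hφ : ∀ x a, ‖M.φ x a‖ ≤ b) (hπ : IsPolicy π) (β : Vec d) :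
    ∑ o, M.obsProb πB o * ‖M.gTheta πB c π β o‖ ^ 2
      ≤ 2 * b ^ 2 * (1 + 4 * (b ^ 2 * ‖β‖ ^ 2)) := by
  calc _ ≤ ∑ o, M.obsProb πB o * (2 * b ^ 2 * (1 + 4 *
          inner ℝ (M.φ o.x o.a) (mulV (matPow (M.cov πB) (c - 1)) β) ^ 2)) :=
        Finset.sum_le_sum fun o _ => mul_le_mul_of_nonneg_left
          (M.norm_gTheta_sq_le hγ hγ1 hπ hφ πB c β o) (M.obsProb_nonneg hγ hγ1 hπB o)
    _ = 2 * b ^ 2 * (1 + 4 * ∑ o, M.obsProb πB o *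
          inner ℝ (M.φ o.x o.a) (mulV (matPow (M.cov πB) (c - 1)) β) ^ 2) := by
        have : ∀ o : Obs X A, M.obsProb πB o * (2 * b ^ 2 * (1 + 4 *
            inner ℝ (M.φ o.x o.a) (mulV (matPow (M.cov πB) (c - 1)) β) ^ 2))
            = 2 * b ^ 2 * (M.obsProb πB o + 4 * (M.obsProb πB o *
              inner ℝ (M.φ o.x o.a) (mulV (matPow (M.cov πB) (c - 1)) β) ^ 2)) := by
          intro o; ring
        simp only [this, ← Finset.mul_sum, Finset.sum_add_distrib, M.sum_obsProb hγ hγ1 hπB]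
    _ ≤ _ := by
        rw [M.sum_obsProb_mul_pair πB fun x a =>
          inner ℝ (M.φ x a) (mulV (matPow (M.cov πB) (c - 1)) β) ^ 2]
        have := M.sum_occ_mul_weight_sq_le hγ hγ1 hπB hS hc hb1 hφ β
        gcongr

lemma sum_obsProb_mul_norm_gBeta_sq_le (hγ : 0 ≤ γ) (hγ1 : γ < 1) (hπB : IsPolicy πB)
    (hS : (M.cov πB).PosDef) (hc : c = 1 / 2 ∨ c = 1) (hb1 : 1 ≤ b)
    (hφ : ∀ x a, ‖M.φ x a‖ ≤ b) (hπ : IsPolicy π) {θ : Vec d} {Dθ : ℝ} (hθ : ‖θ‖ ≤ Dθ) :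
    ∑ o, M.obsProb πB o * ‖M.gBeta πB c π θ o‖ ^ 2
      ≤ (1 + 2 * (b * Dθ)) ^ 2 * (b ^ 2 * (d : ℝ) ^ (2 - 2 * c)) := by
  have hb : 0 ≤ b := by linarith
  have hD : 0 ≤ Dθ := (norm_nonneg _).trans hθ
  have h : ∀ o, ‖M.gBeta πB c π θ o‖ ^ 2 ≤ (1 + 2 * (b * Dθ)) ^ 2 *
      ‖mulV (matPow (M.cov πB) (c - 1)) (M.φ o.x o.a)‖ ^ 2 := by
    intro o
    rw [gBeta, norm_smul, mul_pow]
    refine mul_le_mul_of_nonneg_right (pow_le_pow_left₀ (norm_nonneg _) ?_ 2) (sq_nonneg _)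
    have h1 : |inner ℝ (M.φ o.x o.a) θ| ≤ b * Dθ :=
      (abs_real_inner_le_norm _ _).trans (mul_le_mul (hφ _ _) hθ (norm_nonneg _) hb)
    have h2 : |M.vAt π θ o.x'| ≤ b * Dθ := by
      rw [← inner_phiAt]
      exact (abs_real_inner_le_norm _ _).trans
        (mul_le_mul (M.norm_phiAt_le hπ hφ _) hθ (norm_nonneg _) hb)
    have h3 : |γ * M.vAt π θ o.x'| ≤ b * Dθ := by
      rw [abs_mul, abs_of_nonneg hγ]
      exact (mul_le_of_le_one_left (abs_nonneg _) hγ1.le).trans h2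
    have h4 := M.r_mem o.x o.a
    change |M.r o.x o.a + γ * M.vAt π θ o.x' - inner ℝ (M.φ o.x o.a) θ| ≤ _
    rw [abs_le] at h1 h3 ⊢
    constructor <;> linarith [h1.1, h1.2, h3.1, h3.2, h4.1, h4.2]
  calc _ ≤ ∑ o, M.obsProb πB o * ((1 + 2 * (b * Dθ)) ^ 2 *
          ‖mulV (matPow (M.cov πB) (c - 1)) (M.φ o.x o.a)‖ ^ 2) :=
        Finset.sum_le_sum fun o _ => mul_le_mul_of_nonneg_left (h o)
          (M.obsProb_nonneg hγ hγ1 hπB o)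
    _ = (1 + 2 * (b * Dθ)) ^ 2 * ∑ o, M.obsProb πB o *
          ‖mulV (matPow (M.cov πB) (c - 1)) (M.φ o.x o.a)‖ ^ 2 := by
        rw [Finset.mul_sum]
        exact Finset.sum_congr rfl fun o _ => by ring
    _ ≤ _ := by
        rw [M.sum_obsProb_mul_pair πB fun x a =>
          ‖mulV (matPow (M.cov πB) (c - 1)) (M.φ x a)‖ ^ 2]
        exact mul_le_mul_of_nonneg_left
          (M.sum_occ_mul_norm_sq_le hγ hγ1 hπB hS hc hb1 hφ) (sq_nonneg _)

/-- Normalization of the transition probabilities gives a vector whose pairing with every feature is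
`1`. It rules out small coverage ratios and the case `d = 0`. -/
lemma inner_sum_psi (x : X) (a : A) : inner ℝ (M.φ x a) (∑ y, M.ψ y) = 1 := by
  rw [inner_sum, ← (M.p_mem x a).2]
  exact Finset.sum_congr rfl fun y _ => (M.p_eq x a y).symm

/-- The coverage ratio is bounded away from zero. -/
lemma one_le_mul_coverage (hγ : 0 ≤ γ) (hγ1 : γ < 1) (hπB : IsPolicy πB) (hπs : IsPolicy πs)
    (hS : (M.cov πB).PosDef) (hc : c = 1 / 2 ∨ c = 1) (hb1 : 1 ≤ b)
    (hφ : ∀ x a, ‖M.φ x a‖ ≤ b) :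
    1 ≤ b ^ 2 * M.coverage c πs πB := by
  set Ψ := ∑ y, M.ψ y
  -- Cauchy-Schwarz is applied to `β*` and `Λ^c Ψ`, with `Ψ = ∑ ψ`: their inner product is
  -- `⟨E_{μ^{πs}}[φ], Ψ⟩ = 1`, and `‖Λ^c Ψ‖` is at most `b`.
  have h1 : inner ℝ (M.betaStar πB c πs) (M.featOcc πB c Ψ) = 1 := by
    rw [M.featOcc_eq hS, ← inner_matPow_left, ← M.featOcc_eq hS, M.featOcc_betaStar hS,
      inner_meanFeature]
    simp only [Ψ, inner_sum_psi, mul_one, M.sum_occ hγ hγ1 hπs]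
  have h2 : ‖M.featOcc πB c Ψ‖ ^ 2 ≤ b ^ 2 := by
    rcases hc with rfl | rfl
    · have : ‖M.featOcc πB (1 / 2) Ψ‖ ^ 2 = 1 := by
        rw [M.featOcc_eq hS, ← real_inner_self_eq_norm_sq, inner_matPow_left,
          mulV_matPow_matPow hS, add_halves, matPow_one hS, inner_mulV_cov]
        simp only [Ψ, inner_sum_psi, mul_one, M.sum_occ hγ hγ1 hπB]
      rw [this]
      exact one_le_pow₀ hb1
    · have : M.featOcc πB 1 Ψ = M.meanFeature πB := by
        rw [featOcc, sub_self, matPow_zero hS, mulV_one, mulV_cov]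
        simp only [Ψ, inner_sum_psi, mul_one, meanFeature]
      rw [this]
      refine pow_le_pow_left₀ (norm_nonneg _) ?_ 2
      calc _ ≤ ∑ x, ∑ a, M.occ πB x a * b := by
            refine (norm_sum_le _ _).trans (Finset.sum_le_sum fun x _ =>
              (norm_sum_le _ _).trans (Finset.sum_le_sum fun a _ => ?_))
            have h0 := M.occ_nonneg hγ hγ1 hπB x a
            rw [norm_smul, Real.norm_eq_abs, abs_of_nonneg h0]
            exact mul_le_mul_of_nonneg_left (hφ x a) h0
        _ = b := by simp only [← Finset.sum_mul, M.sum_occ hγ hγ1 hπB, one_mul]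
  have h3 := real_inner_le_norm (M.betaStar πB c πs) (M.featOcc πB c Ψ)
  rw [h1] at h3
  calc (1 : ℝ) ≤ (‖M.betaStar πB c πs‖ * ‖M.featOcc πB c Ψ‖) ^ 2 := one_le_pow₀ h3
    _ = ‖M.featOcc πB c Ψ‖ ^ 2 * M.coverage c πs πB := by
        rw [mul_pow, M.norm_betaStar_sq hS, mul_comm]
    _ ≤ _ := mul_le_mul_of_nonneg_right h2 (by rw [← M.norm_betaStar_sq hS]; positivity)

end LinearMDP

open MeasureTheory ProbabilityTheory

/-! ### Integration over finite-valued independent variables. -/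

section FiniteIndependence

variable {Ω E O : Type*} [MeasurableSpace Ω] {P : Measure Ω} [IsProbabilityMeasure P]
  [MeasurableSpace E] [Finite E] [MeasurableSingletonClass E]
  [MeasurableSpace O] [Fintype O] [DiscreteMeasurableSpace O]

/-- A function of a finite-valued variable is automatically measurable and bounded. All
measurability questions about the algorithm thus reduce to which observations a quantity depends on.
-/
lemma integrable_of_factors {Y : Ω → E} (hY : Measurable Y) {F : Ω → ℝ}
    (hF : ∀ w w', Y w = Y w' → F w = F w') : Integrable F P := by
  have hF' : F.FactorsThrough Y := fun w w' h => hF w w' h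
  rw [← hF'.extend_comp fun _ => (0 : ℝ)]
  have : IsFiniteMeasure (P.map Y) := inferInstance
  exact (Integrable.of_finite (μ := P.map Y)).comp_measurable hY

/-- Integrating out a finite-valued random variable that is independent of the rest. -/
lemma integral_eq_integral_sum_of_indepFun {Y : Ω → E} {Z : Ω → O} (hY : Measurable Y)
    (hZ : Measurable Z) (hYZ : IndepFun Y Z P) {H : Ω → O → ℝ}
    (hH : ∀ o w w', Y w = Y w' → H w o = H w' o) :
    ∫ w, H w (Z w) ∂P = ∫ w, ∑ o, P.real (Z ⁻¹' {o}) * H w o ∂P := by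
  classical
  have hi : ∀ o, Integrable (fun w => H w o) P := fun o => integrable_of_factors hY (hH o)
  -- Splitting over the values of `Z` turns the integrand into a sum of products of independent
  -- factors.
  have h1 : ∀ w, H w (Z w) = ∑ o, H w o * (if Z w = o then 1 else 0) := by simp
  have hint : ∀ o, Integrable (fun w => H w o * (if Z w = o then 1 else 0)) P := fun o =>
    integrable_of_factors (hY.prodMk hZ) fun w w' h => by
      rw [Prod.mk.injEq] at h
      rw [hH o w w' h.1, h.2]
  simp only [h1]
  rw [integral_finsetSum _ fun o _ => hint o, integral_finsetSum _ fun o _ => (hi o).const_mul _]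
  refine Finset.sum_congr rfl fun o _ => ?_
  have hf : (fun w => H w o).FactorsThrough Y := fun w w' h => hH o w w' h
  have hm : Measurable fun z : O => if z = o then (1 : ℝ) else 0 := measurable_of_finite _
  have h2 : IndepFun (fun w => H w o) (fun w => if Z w = o then (1 : ℝ) else 0) P := by
    rw [← hf.extend_comp fun _ => (0 : ℝ)]
    exact hYZ.comp (measurable_of_finite _) hm
  have h3 : ∫ w, (if Z w = o then (1 : ℝ) else 0) ∂P = P.real (Z ⁻¹' {o}) := by
    have : (fun w => if Z w = o then (1 : ℝ) else 0) = (Z ⁻¹' {o}).indicator 1 := by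
      funext w; simp [Set.indicator]
    rw [this, integral_indicator_one (hZ (measurableSet_singleton o))]
  rw [h2.integral_fun_mul_eq_mul_integral (hi o).aestronglyMeasurable
    (hm.comp hZ).aestronglyMeasurable, h3, integral_const_mul, mul_comm]

end FiniteIndependence

/-! ### Dependence of the iterates on the data, and conditioning on the past. -/

namespace LinearMDP

variable {X A : Type*} [Fintype X] [Fintype A] [DecidableEq X] [DecidableEq A]
  {d : ℕ} {γ : ℝ} (M : LinearMDP X A d γ) {πB πs : X → A → ℝ}

section Measurability

variable {C : Config d}

lemma innerIter_congr (s : AlgState d) {W W' : ℕ → Obs X A} {k : ℕ}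
    (h : ∀ j < k, W j = W' j) : M.innerIter πB C s W k = M.innerIter πB C s W' k := by
  induction k with
  | zero => rfl
  | succ k ih =>
    rw [innerIter, innerIter, ih fun j hj => h j (hj.trans k.lt_succ_self), h k k.lt_succ_self]

/-- Only `K - 1` observations enter the average, so the last one of the round is still fresh for the
step on `β`. -/
lemma thetaAvg_congr (s : AlgState d) {W W' : ℕ → Obs X A}
    (h : ∀ j < C.K - 1, W j = W' j) : M.thetaAvg πB C s W = M.thetaAvg πB C s W' := by
  rw [thetaAvg, thetaAvg]
  congr 1
  refine Finset.sum_congr rfl fun k hk => M.innerIter_congr s fun j hj => h j ?_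
  have := Finset.mem_range.1 hk
  omega

lemma run_congr (hK : 0 < C.K) {W W' : ℕ → ℕ → Obs X A} {t : ℕ}
    (h : ∀ i < t, ∀ j < C.K, W i j = W' i j) : M.run πB C W t = M.run πB C W' t := by
  induction t with
  | zero => rfl
  | succ t ih =>
    rw [run, run, ih fun i hi => h i (hi.trans t.lt_succ_self), step, step,
      M.thetaAvg_congr _ fun j hj => h t t.lt_succ_self j (by omega),
      h t t.lt_succ_self (C.K - 1) (by omega)]

lemma norm_innerIter_le (hD : 0 ≤ C.Dθ) {s : AlgState d} (hs : ‖s.θ‖ ≤ C.Dθ)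
    (W : ℕ → Obs X A) (k : ℕ) : ‖M.innerIter πB C s W k‖ ≤ C.Dθ := by
  cases k with
  | zero => exact hs
  | succ k => exact norm_projBall_le hD _

lemma norm_thetaAvg_le (hK : 0 < C.K) (hD : 0 ≤ C.Dθ) {s : AlgState d} (hs : ‖s.θ‖ ≤ C.Dθ)
    (W : ℕ → Obs X A) : ‖M.thetaAvg πB C s W‖ ≤ C.Dθ := by
  have hK' : (0 : ℝ) < C.K := by exact_mod_cast hK
  rw [thetaAvg, norm_smul, Real.norm_eq_abs, abs_of_nonneg (by positivity), one_div,
    inv_mul_le_iff₀ hK']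
  refine (norm_sum_le _ _).trans ?_
  simpa using Finset.sum_le_sum fun k (_ : k ∈ Finset.range C.K) =>
    M.norm_innerIter_le (πB := πB) hD hs W k

lemma norm_run_le (hK : 0 < C.K) (hDθ : 0 ≤ C.Dθ) (hDβ : 0 ≤ C.Dβ) (hθ : ‖C.θ₀‖ ≤ C.Dθ)
    (hβ : ‖C.β₁‖ ≤ C.Dβ) (W : ℕ → ℕ → Obs X A) (t : ℕ) :
    ‖(M.run πB C W t).θ‖ ≤ C.Dθ ∧ ‖(M.run πB C W t).β‖ ≤ C.Dβ := by
  induction t with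
  | zero => exact ⟨hθ, hβ⟩
  | succ t ih => exact ⟨M.norm_thetaAvg_le hK hDθ ih.1 _, norm_projBall_le hDβ _⟩

end Measurability

section Sampling

variable {T K : ℕ} {Ω : Type*} [MeasurableSpace Ω] {P : Measure Ω} [IsProbabilityMeasure P]
  {W : ℕ → ℕ → Ω → Obs X A} {J : Ω → Fin T}

lemma integrable_of_data (hW : IsSampling (K := K) M πB P W J) {F : Ω → ℝ}
    (hF : ∀ w w', (∀ t < T, ∀ k < K, W t k w = W t k w') → F w = F w') : Integrable F P := by
  refine integrable_of_factors (Y := fun w (i : Fin T × Fin K) => W i.1 i.2 w)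
    (measurable_pi_lambda _ hW.measurable_data) fun w w' h => hF w w' fun t ht k hk => ?_
  exact congr_fun h (⟨t, ht⟩, ⟨k, hk⟩)

/-- Integrating out the observation `W t k`, given all the earlier ones. -/
lemma integral_fresh_obs (hW : IsSampling (K := K) M πB P W J) {t k : ℕ} (ht : t < T) (hk : k < K)
    {H : Ω → Obs X A → ℝ}
    (hH : ∀ o w w', (∀ i < t, ∀ j < K, W i j w = W i j w') → (∀ j < k, W t j w = W t j w') →
      H w o = H w' o) :
    ∫ w, H w (W t k w) ∂P = ∫ w, ∑ o, M.obsProb πB o * H w o ∂P := by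
  classical
  let j₀ : Fin T × Fin K := (⟨t, ht⟩, ⟨k, hk⟩)
  -- The indices that precede `(t, k)` in lexicographic order, that is, in the order of use.
  let S : Finset (Fin T × Fin K) :=
    Finset.univ.filter fun i => i.1.1 < t ∨ (i.1.1 = t ∧ i.2.1 < k)
  have hd : Disjoint S {j₀} := by
    rw [Finset.disjoint_singleton_right]
    simp [S, j₀]
  have hm : Measurable fun z : ({j₀} : Finset (Fin T × Fin K)) → Obs X A =>
      z ⟨j₀, Finset.mem_singleton_self j₀⟩ := measurable_pi_apply _
  have hind := (hW.indep.indepFun_finset S {j₀} hd hW.measurable_data).comp measurable_id hm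
  have h := integral_eq_integral_sum_of_indepFun (P := P)
    (Y := fun w (i : S) => W i.1.1 i.1.2 w) (Z := W t k) (H := H)
    (measurable_pi_lambda _ fun i => hW.measurable_data i.1) (hW.measurable_data j₀) hind
    fun o w w' hw => hH o w w'
      (fun i hi j hj => congr_fun hw ⟨(⟨i, hi.trans ht⟩, ⟨j, hj⟩), by simp [S, hi]⟩)
      (fun j hj => congr_fun hw ⟨(⟨t, ht⟩, ⟨j, hj.trans hk⟩), by simp [S, hj]⟩)
  rw [h]
  have hl : ∀ o, P.real (W t k ⁻¹' {o}) = M.obsProb πB o := fun o => hW.law j₀ o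
  simp only [hl]

/-- Integrating out the uniform index `J`. -/
lemma integral_index (hW : IsSampling (K := K) M πB P W J) {H : Ω → Fin T → ℝ}
    (hH : ∀ o w w', (∀ t < T, ∀ k < K, W t k w = W t k w') → H w o = H w' o) :
    ∫ w, H w (J w) ∂P = (1 / (T : ℝ)) * ∑ t : Fin T, ∫ w, H w t ∂P := by
  have h := integral_eq_integral_sum_of_indepFun (P := P)
    (Y := fun w (i : Fin T × Fin K) => W i.1 i.2 w) (Z := J) (H := H)
    (measurable_pi_lambda _ hW.measurable_data) hW.measurable_index hW.index_indep.symm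
    fun o w w' hw => hH o w w' fun t ht k hk => congr_fun hw (⟨t, ht⟩, ⟨k, hk⟩)
  rw [h]
  simp only [hW.index_law, ← Finset.mul_sum]
  rw [integral_const_mul, integral_finsetSum _ fun t _ => M.integrable_of_data hW (hH t)]

end Sampling

end LinearMDP

/-! ### Regret bounds for the three players. -/

lemma integral_le_sub_add {Ω : Type*} [MeasurableSpace Ω] {P : Measure Ω}
    [IsProbabilityMeasure P] {F G H : Ω → ℝ} {r q : ℝ} (hF : Integrable F P) (hG : Integrable G P)
    (hH : Integrable H P) (h : ∀ w, F w ≤ G w - r * H w + q) :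
    ∫ w, F w ∂P ≤ ∫ w, G w ∂P - r * ∫ w, H w ∂P + q := by
  have hGH : Integrable (fun w => G w - r * H w) P := hG.sub (hH.const_mul r)
  refine (integral_mono hF (hGH.add (integrable_const q)) h).trans (le_of_eq ?_)
  rw [integral_add' hGH (integrable_const q), integral_sub hG (hH.const_mul r),
    integral_const_mul]
  simp

/-- Expected progress of a projected stochastic gradient step towards a feasible point `u`. -/
lemma sum_mul_norm_projBall_sub_sq_le {ι : Type*} [Fintype ι] {d : ℕ} {p : ι → ℝ}
    (hp : ∀ i, 0 ≤ p i) (hp1 : ∑ i, p i = 1) {D : ℝ} {u : Vec d} (hu : ‖u‖ ≤ D) (y : Vec d)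
    (r : ℝ) (g : ι → Vec d) :
    ∑ i, p i * ‖projBall D (y + r • g i) - u‖ ^ 2 ≤ ‖y - u‖ ^ 2
      + 2 * r * ∑ i, p i * inner ℝ (g i) (y - u) + r ^ 2 * ∑ i, p i * ‖g i‖ ^ 2 := by
  calc _ ≤ ∑ i, p i * ‖y + r • g i - u‖ ^ 2 := Finset.sum_le_sum fun i _ =>
        mul_le_mul_of_nonneg_left (norm_projBall_sub_le _ hu) (hp i)
    _ = ∑ i, (p i * ‖y - u‖ ^ 2 + 2 * r * (p i * inner ℝ (g i) (y - u))
          + r ^ 2 * (p i * ‖g i‖ ^ 2)) := by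
        refine Finset.sum_congr rfl fun i _ => ?_
        rw [add_sub_right_comm, norm_add_sq_real, real_inner_smul_right, norm_smul, mul_pow,
          Real.norm_eq_abs, sq_abs, real_inner_comm]
        ring
    _ = _ := by
        simp only [Finset.sum_add_distrib, ← Finset.mul_sum, ← Finset.sum_mul, hp1, one_mul]

/-- Bound on the second moment of the stochastic gradients of the primal player. -/
def gradBoundTheta (b Dβ : ℝ) : ℝ := 2 * b ^ 2 * (1 + 4 * (b ^ 2 * Dβ ^ 2))

/-- Bound on the second moment of the stochastic gradients of the dual player. -/
def gradBoundBeta (d : ℕ) (c b Dθ : ℝ) : ℝ :=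
  (1 + 2 * (b * Dθ)) ^ 2 * (b ^ 2 * (d : ℝ) ^ (2 - 2 * c))

namespace LinearMDP

variable {X A : Type*} [Fintype X] [Fintype A] [DecidableEq X] [DecidableEq A]
  {d : ℕ} {γ : ℝ}

/-- Standing assumptions on the MDP, the policies and the configuration of the algorithm; `b`
bounds the features. -/
structure Admissible (M : LinearMDP X A d γ) (πB πs : X → A → ℝ) (C : Config d) (b : ℝ) :
    Prop where
  discount_nonneg : 0 ≤ γ
  discount_lt_one : γ < 1
  behaviour : IsPolicy πB
  comparator : IsPolicy πs
  cov_posDef : (M.cov πB).PosDef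
  exponent : C.c = 1 / 2 ∨ C.c = 1
  one_le_bound : 1 ≤ b
  norm_feature_le : ∀ x a, ‖M.φ x a‖ ≤ b
  norm_thetaOf_le : ∀ π, IsPolicy π → ‖M.thetaOf π‖ ≤ C.Dθ
  coverage_le : M.coverage C.c πs πB ≤ C.Dβ ^ 2
  radius_nonneg : 0 ≤ C.Dβ
  alpha_pos : 0 < C.α
  zeta_pos : 0 < C.ζ
  eta_pos : 0 < C.η
  rounds_pos : 0 < C.K
  alpha_small : C.α * (b * C.Dθ) ≤ 1
  norm_theta_le : ‖C.θ₀‖ ≤ C.Dθ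
  norm_beta_le : ‖C.β₁‖ ≤ C.Dβ

variable {M : LinearMDP X A d γ} {πB πs π : X → A → ℝ} {C : Config d} {b : ℝ}

lemma Admissible.radiusTheta_nonneg (h : M.Admissible πB πs C b) : 0 ≤ C.Dθ :=
  (norm_nonneg _).trans h.norm_theta_le

lemma Admissible.norm_betaStar_le (h : M.Admissible πB πs C b) :
    ‖M.betaStar πB C.c πs‖ ≤ C.Dβ :=
  le_of_sq_le_sq (by rw [M.norm_betaStar_sq h.cov_posDef]; exact h.coverage_le) h.radius_nonneg

lemma Admissible.theta_step (h : M.Admissible πB πs C b) (hπ : IsPolicy π) {β : Vec d}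
    (hβ : ‖β‖ ≤ C.Dβ) {u : Vec d} (hu : ‖u‖ ≤ C.Dθ) (θ : Vec d) :
    ∑ o, M.obsProb πB o * ‖projBall C.Dθ (θ - C.η • M.gTheta πB C.c π β o) - u‖ ^ 2
      ≤ ‖θ - u‖ ^ 2 - 2 * C.η * M.lagrangianDeriv π (M.featOcc πB C.c β) (θ - u)
        + C.η ^ 2 * gradBoundTheta b C.Dβ := by
  have h1 := sum_mul_norm_projBall_sub_sq_le
    (M.obsProb_nonneg h.discount_nonneg h.discount_lt_one h.behaviour)
    (M.sum_obsProb h.discount_nonneg h.discount_lt_one h.behaviour) hu θ (-C.η)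
    (M.gTheta πB C.c π β)
  rw [M.sum_obsProb_mul_inner_gTheta h.discount_nonneg h.discount_lt_one h.behaviour] at h1
  simp only [neg_smul, ← sub_eq_add_neg] at h1
  have h2 := M.sum_obsProb_mul_norm_gTheta_sq_le h.discount_nonneg h.discount_lt_one h.behaviour
    h.cov_posDef h.exponent h.one_le_bound h.norm_feature_le hπ β
  have h3 : 2 * b ^ 2 * (1 + 4 * (b ^ 2 * ‖β‖ ^ 2)) ≤ gradBoundTheta b C.Dβ := by
    unfold gradBoundTheta
    gcongr
  have h4 := mul_le_mul_of_nonneg_left (h2.trans h3) (sq_nonneg C.η)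
  linarith

lemma Admissible.beta_step (h : M.Admissible πB πs C b) (hπ : IsPolicy π) {θ : Vec d}
    (hθ : ‖θ‖ ≤ C.Dθ) (β : Vec d) :
    ∑ o, M.obsProb πB o *
        ‖projBall C.Dβ (β + C.ζ • M.gBeta πB C.c π θ o) - M.betaStar πB C.c πs‖ ^ 2
      ≤ ‖β - M.betaStar πB C.c πs‖ ^ 2
        - 2 * C.ζ * inner ℝ (M.meanFeature πs - M.featOcc πB C.c β) (M.bellmanErr π θ)
        + C.ζ ^ 2 * gradBoundBeta d C.c b C.Dθ := by
  have h1 := sum_mul_norm_projBall_sub_sq_le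
    (M.obsProb_nonneg h.discount_nonneg h.discount_lt_one h.behaviour)
    (M.sum_obsProb h.discount_nonneg h.discount_lt_one h.behaviour) h.norm_betaStar_le β C.ζ
    (M.gBeta πB C.c π θ)
  rw [M.sum_obsProb_mul_inner_gBeta, featOcc_sub, M.featOcc_betaStar h.cov_posDef] at h1
  have h2 := M.sum_obsProb_mul_norm_gBeta_sq_le h.discount_nonneg h.discount_lt_one h.behaviour
    h.cov_posDef h.exponent h.one_le_bound h.norm_feature_le hπ hθ
  have h4 := mul_le_mul_of_nonneg_left h2 (sq_nonneg C.ζ)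
  rw [gradBoundBeta]
  rw [← neg_sub (M.meanFeature πs), inner_neg_left] at h1
  linarith

variable (M) in
/-- Potential of the exponential-weights player against the comparator `πs`. -/
def logPotential (πs : X → A → ℝ) (α : ℝ) (S : Vec d) : ℝ :=
  ∑ x, M.stateOcc πs x * (1 / α * Real.log (∑ a, Real.exp (α * inner ℝ (M.φ x a) S)))
    - inner ℝ (M.meanFeature πs) S

/-- The one-step bound on the log-partition function in each state is averaged over `ν^{π*}`; the
linear part of the potential supplies the gain of the comparator. -/
lemma Admissible.policy_step [Nonempty A] (h : M.Admissible πB πs C b) {θ : Vec d}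
    (hθ : ‖θ‖ ≤ C.Dθ) (S : Vec d) :
    M.logPotential πs C.α (S + θ) ≤ M.logPotential πs C.α S
      - (inner ℝ (M.meanFeature πs) θ - ∑ x, M.stateOcc πs x * M.vAt (M.softmax C.α S) θ x)
      + C.α * (b * C.Dθ) ^ 2 := by
  have hα := h.alpha_pos
  have hx : ∀ x, 1 / C.α * Real.log (∑ a, Real.exp (C.α * inner ℝ (M.φ x a) (S + θ)))
      ≤ 1 / C.α * Real.log (∑ a, Real.exp (C.α * inner ℝ (M.φ x a) S))
        + M.vAt (M.softmax C.α S) θ x + C.α * (b * C.Dθ) ^ 2 := by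
    intro x
    have h1 := log_sum_exp_add_le (fun a => C.α * inner ℝ (M.φ x a) S)
      (fun a => C.α * inner ℝ (M.φ x a) θ) h.alpha_small (fun a => by
        rw [abs_mul, abs_of_pos hα]
        exact mul_le_mul_of_nonneg_left ((abs_real_inner_le_norm _ _).trans
          (mul_le_mul (h.norm_feature_le x a) hθ (norm_nonneg _)
            (zero_le_one.trans h.one_le_bound))) hα.le)
    have h2 : ∑ a, (Real.exp (C.α * inner ℝ (M.φ x a) S) /
        ∑ a', Real.exp (C.α * inner ℝ (M.φ x a') S)) * (C.α * inner ℝ (M.φ x a) θ)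
        = C.α * M.vAt (M.softmax C.α S) θ x := by
      rw [vAt, Finset.mul_sum]
      exact Finset.sum_congr rfl fun a _ => by rw [softmax]; ring
    rw [h2] at h1
    simp only [inner_add_right, mul_add]
    refine (mul_le_mul_of_nonneg_left h1 (one_div_pos.2 hα).le).trans (le_of_eq ?_)
    field_simp
  have h3 := Finset.sum_le_sum fun x (_ : x ∈ Finset.univ) => mul_le_mul_of_nonneg_left (hx x)
    (M.stateOcc_nonneg h.discount_nonneg h.discount_lt_one h.comparator x)
  simp only [mul_add, Finset.sum_add_distrib, ← Finset.sum_mul,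
    M.sum_stateOcc h.discount_nonneg h.discount_lt_one h.comparator, one_mul] at h3
  simp only [logPotential, inner_add_right]
  simp only [inner_add_right, mul_add] at h3 ⊢
  linarith

/-- In each state the log-sum-exp dominates every exponent, hence also their mean under `πs`. -/
lemma Admissible.logPotential_nonneg (h : M.Admissible πB πs C b) (S : Vec d) :
    0 ≤ M.logPotential πs C.α S := by
  have hα := h.alpha_pos
  rw [logPotential, inner_meanFeature, ← Finset.sum_sub_distrib]
  refine Finset.sum_nonneg fun x _ => ?_
  rw [sub_nonneg, ← M.sum_occ_action h.comparator, Finset.sum_mul]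
  refine Finset.sum_le_sum fun a _ => mul_le_mul_of_nonneg_left ?_
    (M.occ_nonneg h.discount_nonneg h.discount_lt_one h.comparator x a)
  rw [one_div, ← div_eq_inv_mul, le_div_iff₀ hα, mul_comm]
  exact le_log_sum_exp (fun a => C.α * inner ℝ (M.φ x a) S) a

lemma Admissible.logPotential_zero (h : M.Admissible πB πs C b) :
    M.logPotential πs C.α 0 = Real.log (Fintype.card A) / C.α := by
  simp only [logPotential, inner_zero_right, mul_zero, Real.exp_zero, Finset.sum_const,
    Finset.card_univ, nsmul_eq_mul, mul_one, ← Finset.sum_mul,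
    M.sum_stateOcc h.discount_nonneg h.discount_lt_one h.comparator]
  ring

lemma lagrangianDeriv_thetaAvg_sub (hγ : 0 ≤ γ) (hγ1 : γ < 1) (hπB : IsPolicy πB)
    (hK : 0 < C.K) (s : AlgState d) (W : ℕ → Obs X A) (π : X → A → ℝ) (β u : Vec d) :
    M.lagrangianDeriv π (M.featOcc πB C.c β) (M.thetaAvg πB C s W - u)
      = (1 / (C.K : ℝ)) * ∑ k ∈ Finset.range C.K,
        M.lagrangianDeriv π (M.featOcc πB C.c β) (M.innerIter πB C s W k - u) := by
  have hK' : (C.K : ℝ) ≠ 0 := by exact_mod_cast hK.ne'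
  -- Representing the derivative as the inner product with the mean gradient gives its linearity.
  have hlin : ∀ v, M.lagrangianDeriv π (M.featOcc πB C.c β) v
      = inner ℝ (∑ o, M.obsProb πB o • M.gTheta πB C.c π β o) v := by
    intro v
    rw [← M.sum_obsProb_mul_inner_gTheta hγ hγ1 hπB]
    simp only [sum_inner, real_inner_smul_left]
  have h1 : M.thetaAvg πB C s W - u
      = (1 / (C.K : ℝ)) • ∑ k ∈ Finset.range C.K, (M.innerIter πB C s W k - u) := by
    rw [thetaAvg, Finset.sum_sub_distrib, smul_sub, Finset.sum_const, Finset.card_range,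
      ← Nat.cast_smul_eq_nsmul ℝ, smul_smul, one_div, inv_mul_cancel₀ hK', one_smul]
  simp only [hlin]
  rw [h1, real_inner_smul_right, inner_sum]

variable {T : ℕ} {Ω : Type*} [MeasurableSpace Ω] {P : Measure Ω} [IsProbabilityMeasure P]
  {W : ℕ → ℕ → Ω → Obs X A} {J : Ω → Fin T}

/-- Expected regret of the inner loop against the parameter of the current policy. -/
lemma Admissible.integral_lagrangianDeriv_le [Nonempty A] (h : M.Admissible πB πs C b)
    (hW : IsSampling (K := C.K) M πB P W J) {t : ℕ} (ht : t < T) (s : Ω → AlgState d)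
    (hs : ∀ w, s w = M.run πB C (fun t k => W t k w) t) :
    ∫ w, M.lagrangianDeriv (M.softmax C.α (s w).S) (M.featOcc πB C.c (s w).β)
        (M.thetaAvg πB C (s w) (fun k => W t k w) - M.thetaOf (M.softmax C.α (s w).S)) ∂P
      ≤ 2 * C.Dθ ^ 2 / (C.η * C.K) + C.η * gradBoundTheta b C.Dβ / 2 := by
  have hK : (0 : ℝ) < C.K := by exact_mod_cast h.rounds_pos
  have hη := h.eta_pos
  have hπ : ∀ w, IsPolicy (M.softmax C.α (s w).S) := fun w => M.softmax_isPolicy _ _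
  have hsn : ∀ w, ‖(s w).θ‖ ≤ C.Dθ ∧ ‖(s w).β‖ ≤ C.Dβ := fun w => by
    rw [hs]
    exact M.norm_run_le h.rounds_pos h.radiusTheta_nonneg h.radius_nonneg h.norm_theta_le
      h.norm_beta_le _ t
  have hsc : ∀ w w', (∀ i < t, ∀ j < C.K, W i j w = W i j w') → s w = s w' := fun w w' hw => by
    rw [hs, hs]
    exact M.run_congr h.rounds_pos hw
  -- The comparator is random but fixed by the earlier rounds, so it stays constant while the
  -- observations of the current round are integrated out.
  set u : Ω → Vec d := fun w => M.thetaOf (M.softmax C.α (s w).S) with hu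
  set θ : ℕ → Ω → Vec d := fun k w => M.innerIter πB C (s w) (fun k => W t k w) k with hθ
  set L : ℕ → Ω → ℝ := fun k w => M.lagrangianDeriv (M.softmax C.α (s w).S)
    (M.featOcc πB C.c (s w).β) (θ k w - u w) with hL
  have huc : ∀ w w', (∀ i < t, ∀ j < C.K, W i j w = W i j w') → u w = u w' := fun w w' hw => by
    simp only [hu, hsc w w' hw]
  have hθc : ∀ k w w', (∀ i < t, ∀ j < C.K, W i j w = W i j w') →
      (∀ j < k, W t j w = W t j w') → θ k w = θ k w' := fun k w w' hw hw' => by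
    simp only [hθ, hsc w w' hw]
    exact M.innerIter_congr _ hw'
  have hθd : ∀ k ≤ C.K, ∀ w w', (∀ i < T, ∀ j < C.K, W i j w = W i j w') → θ k w = θ k w' :=
    fun k hk w w' hw => hθc k w w' (fun i hi => hw i (hi.trans ht))
      fun j hj => hw t ht j (hj.trans_le hk)
  have hF : ∀ k ≤ C.K, Integrable (fun w => ‖θ k w - u w‖ ^ 2) P := fun k hk =>
    M.integrable_of_data hW fun w w' hw => by
      simp only [hθd k hk w w' hw, huc w w' fun i hi => hw i (hi.trans ht)]
  have hLi : ∀ k ≤ C.K, Integrable (L k) P := fun k hk =>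
    M.integrable_of_data hW fun w w' hw => by
      simp only [hL, hθd k hk w w' hw, huc w w' fun i hi => hw i (hi.trans ht),
        hsc w w' fun i hi => hw i (hi.trans ht)]
  have hstep : ∀ k < C.K, ∫ w, ‖θ (k + 1) w - u w‖ ^ 2 ∂P
      ≤ ∫ w, ‖θ k w - u w‖ ^ 2 ∂P - 2 * C.η * ∫ w, L k w ∂P
        + C.η ^ 2 * gradBoundTheta b C.Dβ := by
    intro k hk
    have h1 := M.integral_fresh_obs hW ht hk (H := fun w o => ‖projBall C.Dθ (θ k w -
      C.η • M.gTheta πB C.c (M.softmax C.α (s w).S) (s w).β o) - u w‖ ^ 2)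
      fun o w w' hw hw' => by simp only [hθc k w w' hw hw', huc w w' hw, hsc w w' hw]
    change ∫ w, ‖θ (k + 1) w - u w‖ ^ 2 ∂P = _ at h1
    rw [h1]
    refine integral_le_sub_add (M.integrable_of_data hW fun w w' hw => ?_) (hF k hk.le)
      (hLi k hk.le) fun w => ?_
    · simp only [hθd k hk.le w w' hw, huc w w' fun i hi => hw i (hi.trans ht),
        hsc w w' fun i hi => hw i (hi.trans ht)]
    · exact h.theta_step (hπ w) (hsn w).2 (h.norm_thetaOf_le _ (hπ w)) (θ k w)
  -- The constant `4 Dθ²` is the squared diameter of the ball, which contains both the starting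
  -- point and the comparator.
  have htel : ∀ k ≤ C.K, ∫ w, ‖θ k w - u w‖ ^ 2 ∂P + 2 * C.η * ∑ j ∈ Finset.range k,
      ∫ w, L j w ∂P ≤ 4 * C.Dθ ^ 2 + k * (C.η ^ 2 * gradBoundTheta b C.Dβ) := by
    intro k
    induction k with
    | zero =>
      intro _
      have : ∫ w, ‖θ 0 w - u w‖ ^ 2 ∂P ≤ ∫ _, 4 * C.Dθ ^ 2 ∂P := by
        refine integral_mono (hF 0 (Nat.zero_le _)) (integrable_const _) fun w => ?_
        have h1 : ‖θ 0 w - u w‖ ≤ 2 * C.Dθ := (norm_sub_le _ _).trans (by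
          have h2 : ‖θ 0 w‖ ≤ C.Dθ := (hsn w).1
          have h3 : ‖u w‖ ≤ C.Dθ := h.norm_thetaOf_le _ (hπ w)
          linarith)
        calc ‖θ 0 w - u w‖ ^ 2 ≤ (2 * C.Dθ) ^ 2 := pow_le_pow_left₀ (norm_nonneg _) h1 2
          _ = _ := by ring
      simpa using this
    | succ k ih =>
      intro hk
      have h1 := ih (Nat.le_of_succ_le hk)
      have h2 := hstep k hk
      rw [Finset.sum_range_succ]
      push_cast
      linarith
  have hfin := htel C.K le_rfl
  have h0 : 0 ≤ ∫ w, ‖θ C.K w - u w‖ ^ 2 ∂P := integral_nonneg fun w => sq_nonneg _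
  have havg : ∀ w, M.lagrangianDeriv (M.softmax C.α (s w).S) (M.featOcc πB C.c (s w).β)
      (M.thetaAvg πB C (s w) (fun k => W t k w) - u w)
      = (1 / (C.K : ℝ)) * ∑ k ∈ Finset.range C.K, L k w := fun w =>
    M.lagrangianDeriv_thetaAvg_sub h.discount_nonneg h.discount_lt_one h.behaviour h.rounds_pos
      (s w) (fun k => W t k w) (M.softmax C.α (s w).S) (s w).β (u w)
  refine (integral_congr_ae (ae_of_all _ havg)).trans_le ?_
  rw [integral_const_mul, integral_finsetSum _ fun k hk => hLi k (Finset.mem_range.1 hk).le,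
    one_div, inv_mul_le_iff₀ hK]
  have h2 : (C.K : ℝ) * (2 * C.Dθ ^ 2 / (C.η * C.K) + C.η * gradBoundTheta b C.Dβ / 2)
      = (4 * C.Dθ ^ 2 + C.K * (C.η ^ 2 * gradBoundTheta b C.Dβ)) / (2 * C.η) := by
    field_simp
    ring
  rw [h2, le_div_iff₀ (by positivity)]
  linarith

variable (M) in
/-- Suboptimality of `π` against the comparator `πs`. -/
def suboptimality (πs π : X → A → ℝ) : ℝ :=
  ∑ x, ∑ a, (M.occ πs x a - M.occ π x a) * M.r x a

/-- Potential of the outer loop. -/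
def potential (M : LinearMDP X A d γ) (πB πs : X → A → ℝ) (C : Config d) (s : AlgState d) : ℝ :=
  M.logPotential πs C.α s.S + ‖s.β - M.betaStar πB C.c πs‖ ^ 2 / (2 * C.ζ)

/-- Expected decrease of the potential in one round. -/
lemma Admissible.integral_round_le [Nonempty A] (h : M.Admissible πB πs C b)
    (hW : IsSampling (K := C.K) M πB P W J) {t : ℕ} (ht : t < T) :
    ∫ w, M.potential πB πs C (M.run πB C (fun t k => W t k w) (t + 1)) ∂P
      ≤ ∫ w, M.potential πB πs C (M.run πB C (fun t k => W t k w) t) ∂P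
        - ∫ w, M.suboptimality πs (M.policy πB C (fun t k => W t k w) t) ∂P
        + (C.α * (b * C.Dθ) ^ 2 + C.ζ * gradBoundBeta d C.c b C.Dθ / 2
          + (2 * C.Dθ ^ 2 / (C.η * C.K) + C.η * gradBoundTheta b C.Dβ / 2)) := by
  have hζ := h.zeta_pos
  have hKpos := h.rounds_pos
  set s : Ω → AlgState d := fun w => M.run πB C (fun t k => W t k w) t with hs
  have hπ : ∀ w, IsPolicy (M.softmax C.α (s w).S) := fun w => M.softmax_isPolicy _ _
  have hsn : ∀ w, ‖(s w).θ‖ ≤ C.Dθ ∧ ‖(s w).β‖ ≤ C.Dβ := fun w =>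
    M.norm_run_le hKpos h.radiusTheta_nonneg h.radius_nonneg h.norm_theta_le h.norm_beta_le _ t
  have hsc : ∀ w w', (∀ i < t, ∀ j < C.K, W i j w = W i j w') → s w = s w' := fun w w' hw =>
    M.run_congr hKpos hw
  set θ : Ω → Vec d := fun w => M.thetaAvg πB C (s w) (fun k => W t k w) with hθ
  have hθn : ∀ w, ‖θ w‖ ≤ C.Dθ := fun w =>
    M.norm_thetaAvg_le hKpos h.radiusTheta_nonneg (hsn w).1 _
  have hθc : ∀ w w', (∀ i < t, ∀ j < C.K, W i j w = W i j w') →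
      (∀ j < C.K - 1, W t j w = W t j w') → θ w = θ w' := fun w w' hw hw' => by
    simp only [hθ, hsc w w' hw]
    exact M.thetaAvg_congr _ hw'
  have hsd : ∀ w w', (∀ i < T, ∀ j < C.K, W i j w = W i j w') → s w = s w' := fun w w' hw =>
    hsc w w' fun i hi => hw i (hi.trans ht)
  have hθd : ∀ w w', (∀ i < T, ∀ j < C.K, W i j w = W i j w') → θ w = θ w' := fun w w' hw =>
    hθc w w' (fun i hi => hw i (hi.trans ht)) fun j hj => hw t ht j (by omega)
  -- Every integrand below is a function of the state, the averaged parameter and the last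
  -- observation of the round.
  have hint : ∀ f : AlgState d → Vec d → Obs X A → ℝ,
      Integrable (fun w => f (s w) (θ w) (W t (C.K - 1) w)) P := fun f =>
    M.integrable_of_data hW fun w w' hw => by
      simp only [hsd w w' hw, hθd w w' hw, hw t ht (C.K - 1) (by omega)]
  set R₁ : Ω → ℝ := fun w => inner ℝ (M.meanFeature πs) (θ w)
    - ∑ x, M.stateOcc πs x * M.vAt (M.softmax C.α (s w).S) (θ w) x
  set R₂ : Ω → ℝ := fun w => inner ℝ (M.meanFeature πs - M.featOcc πB C.c (s w).β)
    (M.bellmanErr (M.softmax C.α (s w).S) (θ w))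
  set R₃ : Ω → ℝ := fun w => M.lagrangianDeriv (M.softmax C.α (s w).S)
    (M.featOcc πB C.c (s w).β) (θ w - M.thetaOf (M.softmax C.α (s w).S))
  have hR₁ : Integrable R₁ P := hint fun s θ _ => inner ℝ (M.meanFeature πs) θ
    - ∑ x, M.stateOcc πs x * M.vAt (M.softmax C.α s.S) θ x
  have hR₂ : Integrable R₂ P := hint fun s θ _ =>
    inner ℝ (M.meanFeature πs - M.featOcc πB C.c s.β) (M.bellmanErr (M.softmax C.α s.S) θ)
  have hR₃ : Integrable R₃ P := hint fun s θ _ => M.lagrangianDeriv (M.softmax C.α s.S)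
    (M.featOcc πB C.c s.β) (θ - M.thetaOf (M.softmax C.α s.S))
  have hsub : ∫ w, M.suboptimality πs (M.policy πB C (fun t k => W t k w) t) ∂P
      = ∫ w, R₁ w ∂P + ∫ w, R₂ w ∂P + ∫ w, R₃ w ∂P := by
    rw [← integral_add hR₁ hR₂, ← integral_add (f := fun w => R₁ w + R₂ w) (hR₁.add hR₂) hR₃]
    exact integral_congr_ae (ae_of_all _ fun w => M.suboptimality_eq h.discount_nonneg
      h.discount_lt_one h.comparator (hπ w) (M.featOcc πB C.c (s w).β) (θ w))
  have hI₁ : Integrable (fun w => M.logPotential πs C.α ((s w).S + θ w)) P :=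
    hint fun s θ _ => M.logPotential πs C.α (s.S + θ)
  have hI₂ : Integrable (fun w => M.logPotential πs C.α (s w).S) P :=
    hint fun s _ _ => M.logPotential πs C.α s.S
  have hI₃ : Integrable (fun w => ‖projBall C.Dβ ((s w).β + C.ζ • M.gBeta πB C.c
      (M.softmax C.α (s w).S) (θ w) (W t (C.K - 1) w)) - M.betaStar πB C.c πs‖ ^ 2) P :=
    hint fun s θ o => ‖projBall C.Dβ (s.β + C.ζ • M.gBeta πB C.c
      (M.softmax C.α s.S) θ o) - M.betaStar πB C.c πs‖ ^ 2
  have hI₄ : Integrable (fun w => ‖(s w).β - M.betaStar πB C.c πs‖ ^ 2) P :=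
    hint fun s _ _ => ‖s.β - M.betaStar πB C.c πs‖ ^ 2
  have hpol : ∫ w, M.logPotential πs C.α ((s w).S + θ w) ∂P
      ≤ ∫ w, M.logPotential πs C.α (s w).S ∂P - 1 * ∫ w, R₁ w ∂P + C.α * (b * C.Dθ) ^ 2 :=
    integral_le_sub_add hI₁ hI₂ hR₁ fun w => by
      rw [one_mul]
      exact h.policy_step (hθn w) (s w).S
  have hbeta : ∫ w, ‖projBall C.Dβ ((s w).β + C.ζ • M.gBeta πB C.c (M.softmax C.α (s w).S)
      (θ w) (W t (C.K - 1) w)) - M.betaStar πB C.c πs‖ ^ 2 ∂P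
      ≤ ∫ w, ‖(s w).β - M.betaStar πB C.c πs‖ ^ 2 ∂P - 2 * C.ζ * ∫ w, R₂ w ∂P
        + C.ζ ^ 2 * gradBoundBeta d C.c b C.Dθ := by
    -- The observation of index `K - 1` is independent of `θ w`, which depends on smaller indices
    -- only.
    rw [M.integral_fresh_obs hW ht (Nat.sub_lt hKpos one_pos) (H := fun w o =>
      ‖projBall C.Dβ ((s w).β + C.ζ • M.gBeta πB C.c (M.softmax C.α (s w).S)
        (θ w) o) - M.betaStar πB C.c πs‖ ^ 2)
      fun o w w' hw hw' => by simp only [hsc w w' hw, hθc w w' hw hw']]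
    exact integral_le_sub_add (hint fun s θ _ => ∑ o, M.obsProb πB o * ‖projBall C.Dβ (s.β +
      C.ζ • M.gBeta πB C.c (M.softmax C.α s.S) θ o) - M.betaStar πB C.c πs‖ ^ 2) hI₄ hR₂
      fun w => h.beta_step (hπ w) (hθn w) (s w).β
  have htheta : ∫ w, R₃ w ∂P ≤ _ := h.integral_lagrangianDeriv_le hW ht s fun w => rfl
  have hV₁ : ∫ w, M.potential πB πs C (M.run πB C (fun t k => W t k w) (t + 1)) ∂P
      = ∫ w, M.logPotential πs C.α ((s w).S + θ w) ∂P
        + (∫ w, ‖projBall C.Dβ ((s w).β + C.ζ • M.gBeta πB C.c (M.softmax C.α (s w).S)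
          (θ w) (W t (C.K - 1) w)) - M.betaStar πB C.c πs‖ ^ 2 ∂P) / (2 * C.ζ) := by
    rw [← integral_div, ← integral_add hI₁ (hI₃.div_const _)]
    rfl
  have hV₀ : ∫ w, M.potential πB πs C (s w) ∂P
      = ∫ w, M.logPotential πs C.α (s w).S ∂P
        + (∫ w, ‖(s w).β - M.betaStar πB C.c πs‖ ^ 2 ∂P) / (2 * C.ζ) := by
    rw [← integral_div, ← integral_add hI₂ (hI₄.div_const _)]
    rfl
  have hbeta' := div_le_div_of_nonneg_right hbeta (by positivity : 0 ≤ 2 * C.ζ)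
  have hexp : ∀ p q g : ℝ, (p - 2 * C.ζ * q + C.ζ ^ 2 * g) / (2 * C.ζ)
      = p / (2 * C.ζ) - q + C.ζ * g / 2 := by
    intro p q g
    field_simp
  rw [hexp] at hbeta'
  change _ ≤ ∫ w, M.potential πB πs C (s w) ∂P - _ + _
  rw [hV₁, hV₀, hsub]
  linarith

/-- Expected suboptimality of the output of the algorithm. -/
lemma Admissible.integral_suboptimality_le [Nonempty A] (h : M.Admissible πB πs C b) (hT : 0 < T)
    (hW : IsSampling (K := C.K) M πB P W J) :
    ∫ w, M.suboptimality πs (M.policy πB C (fun t k => W t k w) (J w)) ∂P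
      ≤ Real.log (Fintype.card A) / (C.α * T) + C.α * (b * C.Dθ) ^ 2
        + (2 * C.Dβ ^ 2 / (C.ζ * T) + C.ζ * gradBoundBeta d C.c b C.Dθ / 2)
        + (2 * C.Dθ ^ 2 / (C.η * C.K) + C.η * gradBoundTheta b C.Dβ / 2) := by
  have hζ := h.zeta_pos
  have hα := h.alpha_pos
  have hT' : (0 : ℝ) < T := by exact_mod_cast hT
  set δ := C.α * (b * C.Dθ) ^ 2 + C.ζ * gradBoundBeta d C.c b C.Dθ / 2
    + (2 * C.Dθ ^ 2 / (C.η * C.K) + C.η * gradBoundTheta b C.Dβ / 2) with hδ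
  rw [M.integral_index hW
    (H := fun w t => M.suboptimality πs (M.policy πB C (fun t k => W t k w) t))
    fun t w w' hw => by
      simp only [policy]
      rw [M.run_congr h.rounds_pos fun i hi => hw i (hi.trans t.2)]]
  have htel : ∀ n ≤ T, ∑ t ∈ Finset.range n,
      ∫ w, M.suboptimality πs (M.policy πB C (fun t k => W t k w) t) ∂P
      ≤ M.potential πB πs C ⟨C.θ₀, C.β₁, 0⟩
        - ∫ w, M.potential πB πs C (M.run πB C (fun t k => W t k w) n) ∂P + n * δ := by
    intro n
    induction n with
    | zero => intro _; simp [run]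
    | succ n ih =>
      intro hn
      have h1 := h.integral_round_le hW hn
      have h2 := ih (Nat.le_of_succ_le hn)
      rw [Finset.sum_range_succ]
      push_cast
      linarith
  have h1 := htel T le_rfl
  rw [← Fin.sum_univ_eq_sum_range (fun t =>
    ∫ w, M.suboptimality πs (M.policy πB C (fun t k => W t k w) t) ∂P) T] at h1
  have h2 : 0 ≤ ∫ w, M.potential πB πs C (M.run πB C (fun t k => W t k w) T) ∂P :=
    integral_nonneg fun w => add_nonneg (h.logPotential_nonneg _) (by positivity)
  have h3 : M.potential πB πs C ⟨C.θ₀, C.β₁, 0⟩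
      ≤ Real.log (Fintype.card A) / C.α + 2 * C.Dβ ^ 2 / C.ζ := by
    rw [potential, h.logPotential_zero]
    have h4 : ‖C.β₁ - M.betaStar πB C.c πs‖ ≤ 2 * C.Dβ := (norm_sub_le _ _).trans (by
      linarith [h.norm_beta_le, h.norm_betaStar_le])
    have h5 : ‖C.β₁ - M.betaStar πB C.c πs‖ ^ 2 ≤ (2 * C.Dβ) ^ 2 :=
      pow_le_pow_left₀ (norm_nonneg _) h4 2
    have h6 : (2 * C.Dβ) ^ 2 / (2 * C.ζ) = 2 * C.Dβ ^ 2 / C.ζ := by field_simp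
    have h7 := div_le_div_of_nonneg_right h5 (by positivity : 0 ≤ 2 * C.ζ)
    linarith
  rw [one_div, inv_mul_le_iff₀ hT']
  have h8 : (T : ℝ) * (Real.log (Fintype.card A) / (C.α * T) + C.α * (b * C.Dθ) ^ 2
        + (2 * C.Dβ ^ 2 / (C.ζ * T) + C.ζ * gradBoundBeta d C.c b C.Dθ / 2)
        + (2 * C.Dθ ^ 2 / (C.η * C.K) + C.η * gradBoundTheta b C.Dβ / 2))
      = Real.log (Fintype.card A) / C.α + 2 * C.Dβ ^ 2 / C.ζ + T * δ := by
    have e1 : (T : ℝ) * (Real.log (Fintype.card A) / (C.α * T))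
        = Real.log (Fintype.card A) / C.α := by field_simp
    have e2 : (T : ℝ) * (2 * C.Dβ ^ 2 / (C.ζ * T)) = 2 * C.Dβ ^ 2 / C.ζ := by field_simp
    rw [hδ, ← e1, ← e2]
    ring
  rw [h8]
  linarith

end LinearMDP

/-! ### Choice of parameters and the sample count. -/

/-- With the step sizes and numbers of iterations below, the error terms of the algorithm sum up to
at most `ε`. -/
lemma error_terms_le {b Dθ Dβ e ε l K T gβ gθ : ℝ} (hb : 1 ≤ b) (hDθ : 2 ≤ Dθ) (hDβ : 0 < Dβ)
    (hbβ : 1 ≤ b ^ 2 * Dβ ^ 2) (he : 1 ≤ e) (hε : 0 < ε) (hl : 1 / 2 ≤ l)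
    (hgβ : gβ = (1 + 2 * (b * Dθ)) ^ 2 * (b ^ 2 * e))
    (hgθ : gθ = 2 * b ^ 2 * (1 + 4 * (b ^ 2 * Dβ ^ 2)))
    (hK : 360 * b ^ 4 * Dβ ^ 2 * Dθ ^ 2 / ε ^ 2 ≤ K)
    (hT : 1000 * b ^ 4 * e * Dβ ^ 2 * Dθ ^ 2 * l / ε ^ 2 ≤ T) :
    l / (ε / (6 * b ^ 2 * Dθ ^ 2) * T) + ε / (6 * b ^ 2 * Dθ ^ 2) * (b * Dθ) ^ 2
      + (2 * Dβ ^ 2 / (ε / (27 * b ^ 4 * Dθ ^ 2 * e) * T)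
        + ε / (27 * b ^ 4 * Dθ ^ 2 * e) * gβ / 2)
      + (2 * Dθ ^ 2 / (ε / (30 * b ^ 4 * Dβ ^ 2) * K) + ε / (30 * b ^ 4 * Dβ ^ 2) * gθ / 2)
      ≤ ε := by
  have hb0 : 0 < b := by linarith
  have hD0 : 0 < Dθ := by linarith
  have he0 : 0 < e := by linarith
  have hl0 : 0 < l := by linarith
  have hK0 : 0 < K := lt_of_lt_of_le (by positivity) hK
  have hT0 : 0 < T := lt_of_lt_of_le (by positivity) hT
  rw [div_le_iff₀ (by positivity)] at hK hT
  have hbb : 1 ≤ b ^ 2 := one_le_pow₀ hb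
  have hbD : 1 ≤ b * Dθ := by nlinarith
  have e1 : l / (ε / (6 * b ^ 2 * Dθ ^ 2) * T) ≤ ε / 6 := by
    have : l / (ε / (6 * b ^ 2 * Dθ ^ 2) * T) = 6 * b ^ 2 * Dθ ^ 2 * l / (ε * T) := by
      field_simp
    rw [this, div_le_iff₀ (by positivity)]
    -- This term does not need the factor `b² Dβ² e` contained in `T`; the factor is at least `1`
    -- and is simply discarded.
    have h1 : 1 ≤ b ^ 2 * Dβ ^ 2 * e := by nlinarith
    have h2 : b ^ 2 * Dθ ^ 2 * l ≤ b ^ 2 * Dθ ^ 2 * l * (b ^ 2 * Dβ ^ 2 * e) :=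
      le_mul_of_one_le_right (by positivity) h1
    have h3 : (0 : ℝ) ≤ b ^ 2 * Dθ ^ 2 * l := by positivity
    nlinarith
  have e2 : ε / (6 * b ^ 2 * Dθ ^ 2) * (b * Dθ) ^ 2 = ε / 6 := by field_simp
  have e3 : 2 * Dβ ^ 2 / (ε / (27 * b ^ 4 * Dθ ^ 2 * e) * T) ≤ ε / 6 := by
    have : 2 * Dβ ^ 2 / (ε / (27 * b ^ 4 * Dθ ^ 2 * e) * T)
        = 54 * (b ^ 4 * Dθ ^ 2 * e * Dβ ^ 2) / (ε * T) := by
      field_simp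
      ring
    rw [this, div_le_iff₀ (by positivity)]
    have h3 : (0 : ℝ) ≤ b ^ 4 * Dθ ^ 2 * e * Dβ ^ 2 := by positivity
    nlinarith [mul_le_mul_of_nonneg_left hl h3]
  have e4 : ε / (27 * b ^ 4 * Dθ ^ 2 * e) * gβ / 2 ≤ ε / 6 := by
    have h1 : gβ ≤ 9 * b ^ 4 * Dθ ^ 2 * e := by
      have h2 : (1 + 2 * (b * Dθ)) ^ 2 ≤ (3 * (b * Dθ)) ^ 2 :=
        pow_le_pow_left₀ (by positivity) (by linarith) 2
      calc gβ ≤ (3 * (b * Dθ)) ^ 2 * (b ^ 2 * e) := by rw [hgβ]; gcongr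
        _ = _ := by ring
    calc ε / (27 * b ^ 4 * Dθ ^ 2 * e) * gβ / 2
        ≤ ε / (27 * b ^ 4 * Dθ ^ 2 * e) * (9 * b ^ 4 * Dθ ^ 2 * e) / 2 := by gcongr
      _ = ε / 6 := by field_simp; norm_num
  have e5 : 2 * Dθ ^ 2 / (ε / (30 * b ^ 4 * Dβ ^ 2) * K) ≤ ε / 6 := by
    have : 2 * Dθ ^ 2 / (ε / (30 * b ^ 4 * Dβ ^ 2) * K)
        = 60 * (b ^ 4 * Dβ ^ 2 * Dθ ^ 2) / (ε * K) := by
      field_simp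
      ring
    rw [this, div_le_iff₀ (by positivity)]
    nlinarith
  have e6 : ε / (30 * b ^ 4 * Dβ ^ 2) * gθ / 2 ≤ ε / 6 := by
    -- `gθ = 2b² + 8b⁴Dβ²`, and `2b² ≤ 2b⁴Dβ²` since `b²Dβ² ≥ 1`.
    have h1 : gθ ≤ 10 * b ^ 4 * Dβ ^ 2 := by
      rw [hgθ]
      nlinarith
    calc ε / (30 * b ^ 4 * Dβ ^ 2) * gθ / 2
        ≤ ε / (30 * b ^ 4 * Dβ ^ 2) * (10 * b ^ 4 * Dβ ^ 2) / 2 := by gcongr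
      _ = ε / 6 := by field_simp; norm_num
  linarith

lemma natCeil_le_two_mul {k : ℝ} (hk : 1 ≤ k) : (⌈k⌉₊ : ℝ) ≤ 2 * k := by
  linarith [Nat.ceil_lt_add_one (zero_le_one.trans hk)]

/-- The number of samples in terms of the coverage ratio `Cov`. -/
lemma sample_count_le {b κ Dθ Dβ γ ε l c Cov : ℝ} {d : ℕ} (hb : 1 ≤ b) (hd : 0 < d)
    (hγ : 0 ≤ γ) (hγ1 : γ < 1) (hDθ : Dθ = √(d : ℝ) + √(d : ℝ) / (1 - γ)) (hε : 0 < ε)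
    (hε1 : ε ≤ 1) (hl : 1 / 2 ≤ l) (hc : c ≤ 1) (hbβ : 1 ≤ b ^ 2 * Dβ ^ 2)
    (hCov : Dβ ^ 2 = κ ^ 2 * Cov) :
    ((⌈1000 * b ^ 4 * (d : ℝ) ^ (2 - 2 * c) * Dβ ^ 2 * Dθ ^ 2 * l / ε ^ 2⌉₊ *
      ⌈360 * b ^ 4 * Dβ ^ 2 * Dθ ^ 2 / ε ^ 2⌉₊ : ℕ) : ℝ)
      ≤ 23040000 * b ^ 8 * κ ^ 4 * ((d : ℝ) ^ 4 * Cov ^ 2 * l /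
        ((d : ℝ) ^ (2 * c) * (1 - γ) ^ 4 * ε ^ 4)) := by
  have hd1 : (1 : ℝ) ≤ d := by exact_mod_cast hd
  have hd0 : (0 : ℝ) < d := by linarith
  have hs : 1 ≤ √(d : ℝ) := Real.one_le_sqrt.2 hd1
  have hg : 0 < 1 - γ := by linarith
  have hg1 : 1 - γ ≤ 1 := by linarith
  generalize 1 - γ = g at *
  have hDθ1 : 1 ≤ Dθ := by
    have : 0 ≤ √(d : ℝ) / g := by positivity
    linarith
  have hDθ2 : Dθ ≤ 2 * √(d : ℝ) / g := by
    have : √(d : ℝ) ≤ √(d : ℝ) / g := le_div_self (by positivity) hg hg1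
    rw [hDθ, mul_div_assoc, two_mul]
    linarith
  have hDθ4 : Dθ ^ 4 ≤ 16 * (d : ℝ) ^ 2 / g ^ 4 := by
    calc Dθ ^ 4 ≤ (2 * √(d : ℝ) / g) ^ 4 := pow_le_pow_left₀ (by linarith) hDθ2 4
      _ = 16 * (√(d : ℝ) ^ 2) ^ 2 / g ^ 4 := by ring
      _ = _ := by rw [Real.sq_sqrt hd0.le]
  have he : 1 ≤ (d : ℝ) ^ (2 - 2 * c) := Real.one_le_rpow hd1 (by linarith)
  set e := (d : ℝ) ^ (2 - 2 * c) with hedef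
  have hb2 : 1 ≤ b ^ 2 := one_le_pow₀ hb
  have hD2 : 1 ≤ Dθ ^ 2 := one_le_pow₀ hDθ1
  have hε2 : ε ^ 2 ≤ 1 := pow_le_one₀ hε.le hε1
  have hprod : 1 ≤ b ^ 4 * Dβ ^ 2 * Dθ ^ 2 := by
    calc (1 : ℝ) ≤ (b ^ 2 * Dβ ^ 2) * b ^ 2 * Dθ ^ 2 :=
          one_le_mul_of_one_le_of_one_le (one_le_mul_of_one_le_of_one_le hbβ hb2) hD2
      _ = _ := by ring
  have hk : 1 ≤ 360 * b ^ 4 * Dβ ^ 2 * Dθ ^ 2 / ε ^ 2 := by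
    rw [le_div_iff₀ (by positivity)]
    linarith
  have ht : 1 ≤ 1000 * b ^ 4 * e * Dβ ^ 2 * Dθ ^ 2 * l / ε ^ 2 := by
    rw [le_div_iff₀ (by positivity)]
    have h1 : 1 ≤ b ^ 4 * Dβ ^ 2 * Dθ ^ 2 * e := one_le_mul_of_one_le_of_one_le hprod he
    nlinarith
  -- One factor `d²` comes from `Dθ⁴` and `d^{2-2c}` from the gradients for `β`.
  have hde : e * (d : ℝ) ^ 2 = (d : ℝ) ^ 4 / (d : ℝ) ^ (2 * c) := by
    rw [eq_div_iff (Real.rpow_pos_of_pos hd0 _).ne', mul_right_comm, hedef, ← Real.rpow_add hd0,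
      sub_add_cancel, Real.rpow_two]
    ring
  have hX : 0 ≤ b ^ 8 * e * Dβ ^ 4 * l / ε ^ 4 := by
    have : 0 ≤ l := by linarith
    have : 0 ≤ e := by linarith
    positivity
  rw [Nat.cast_mul]
  calc _ ≤ (2 * (1000 * b ^ 4 * e * Dβ ^ 2 * Dθ ^ 2 * l / ε ^ 2)) *
        (2 * (360 * b ^ 4 * Dβ ^ 2 * Dθ ^ 2 / ε ^ 2)) :=
        mul_le_mul (natCeil_le_two_mul ht) (natCeil_le_two_mul hk) (Nat.cast_nonneg _)
          (by linarith)
    _ = 1440000 * (b ^ 8 * e * Dβ ^ 4 * l / ε ^ 4) * Dθ ^ 4 := by ring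
    _ ≤ 1440000 * (b ^ 8 * e * Dβ ^ 4 * l / ε ^ 4) * (16 * (d : ℝ) ^ 2 / g ^ 4) :=
        mul_le_mul_of_nonneg_left hDθ4 (mul_nonneg (by norm_num) hX)
    _ = 23040000 * b ^ 8 * (Dβ ^ 2) ^ 2 * l * (e * (d : ℝ) ^ 2) / (ε ^ 4 * g ^ 4) := by
        ring
    _ = _ := by
        rw [hCov, hde]
        ring

end

end OfflineRL

/-! ### The main theorem. -/

theorem corollary1 (B κ : ℝ) (hB : 0 < B) (hκ : 0 < κ) :
    ∃ M₀ : ℝ, 0 < M₀ ∧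
      ∀ (c γ Dφ Dθ Dβ ε : ℝ) (d N : ℕ), (c = 1 / 2 ∨ c = 1) → 0 ≤ γ → γ < 1 →
        Dφ ≤ B → Dθ = √(d : ℝ) + √(d : ℝ) / (1 - γ) → 2 ≤ N → 0 < ε → ε ≤ 1 →
        ∃ (α ζ η : ℝ) (K T : ℕ), 0 < α ∧ 0 < ζ ∧ 0 < η ∧ 0 < K ∧ 0 < T ∧
          ∀ (X : Type*) (A : Type*) [Fintype X] [Fintype A] [DecidableEq X] [DecidableEq A]
            (M : OfflineRL.LinearMDP X A d γ) (πB πstar : X → A → ℝ),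
            Fintype.card A = N →
            OfflineRL.IsPolicy πB → OfflineRL.IsPolicy πstar →
            (∀ x a, ‖M.φ x a‖ ≤ Dφ) → ‖∑ x, M.ψ x‖ ≤ √(d : ℝ) → ‖M.ω‖ ≤ √(d : ℝ) →
            (∀ π, OfflineRL.IsPolicy π → ‖M.thetaOf π‖ ≤ Dθ) →
            IsUnit (M.cov πB) →
            M.coverage c πstar πB ≤ Dβ ^ 2 → Dβ = κ * √(M.coverage c πstar πB) →
            ((T * K : ℕ) : ℝ) ≤ M₀ * ((d : ℝ) ^ 4 * M.coverage c πstar πB ^ 2 * Real.log N /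
                ((d : ℝ) ^ (2 * c) * (1 - γ) ^ 4 * ε ^ 4)) ∧
            ∀ (θ₀ β₁ : OfflineRL.Vec d), ‖θ₀‖ ≤ Dθ → ‖β₁‖ ≤ Dβ →
              ∀ (Ω : Type*) [MeasurableSpace Ω] (P : MeasureTheory.Measure Ω)
                [MeasureTheory.IsProbabilityMeasure P]
                (W : ℕ → ℕ → Ω → OfflineRL.Obs X A) (J : Ω → Fin T),
                OfflineRL.IsSampling (K := K) M πB P W J →
                ∫ w, (∑ x, ∑ a, (M.occ πstar x a -
                    M.occ (M.policy πB ⟨c, α, ζ, η, Dθ, Dβ, K, θ₀, β₁⟩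
                      (fun t k => W t k w) (J w)) x a) * M.r x a) ∂P ≤ ε := by
  -- A feature bound of at least `1` lets one second-moment estimate serve both values of `c`.
  set b := max B 1 with hbdef
  have hb1 : 1 ≤ b := le_max_right _ _
  have hb0 : 0 < b := by linarith
  -- `23040000 = 4 · 1000 · 360 · 16`: two roundings, the constants in `T` and `K`, and `Dθ⁴ ≤ 16
  -- d²/(1-γ)⁴`.
  refine ⟨23040000 * b ^ 8 * κ ^ 4, by positivity, ?_⟩
  intro c γ Dφ Dθ Dβ ε d N hc hγ hγ1 hDφ hDθ hN hε hε1
  have hl : 1 / 2 ≤ Real.log N := by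
    have h2 : Real.log 2 ≤ Real.log N := Real.log_le_log two_pos (by exact_mod_cast hN)
    linarith [Real.log_two_gt_d9]
  -- No linear MDP with an action has `d = 0`, since a feature pairs to `1` with `∑ ψ`; any
  -- parameters do.
  by_cases hd : d = 0
  · subst hd
    refine ⟨1, 1, 1, 1, 1, one_pos, one_pos, one_pos, one_pos, one_pos, ?_⟩
    intro X A _ _ _ _ M πB πstar hcard
    exfalso
    have : Nonempty A := Fintype.card_pos_iff.1 (by omega)
    obtain ⟨x⟩ : Nonempty X := by
      by_contra hX
      rw [not_nonempty_iff] at hX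
      simpa using M.ν₀_mem.2
    have h1 := M.inner_sum_psi x (Classical.arbitrary A)
    rw [Subsingleton.elim (M.φ x (Classical.arbitrary A)) 0, inner_zero_left] at h1
    exact zero_ne_one h1
  have hdpos : 0 < d := Nat.pos_of_ne_zero hd
  have hcov : ∀ (X : Type _) (A : Type _) [Fintype X] [Fintype A] [DecidableEq X] [DecidableEq A]
      (M : OfflineRL.LinearMDP X A d γ) (πB πstar : X → A → ℝ), OfflineRL.IsPolicy πB →
      OfflineRL.IsPolicy πstar → (∀ x a, ‖M.φ x a‖ ≤ Dφ) → IsUnit (M.cov πB) →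
      1 ≤ b ^ 2 * M.coverage c πstar πB := by
    intro X A _ _ _ _ M πB πstar hπB hπs hφ hu
    exact M.one_le_mul_coverage hγ hγ1 hπB hπs (M.cov_posDef hγ hγ1 hπB hu) hc hb1
      fun x a => (hφ x a).trans (hDφ.trans (le_max_left _ _))
  -- The parameters are chosen before the MDP, so `Dβ ≤ 0` has to be treated; it is vacuous because
  -- the coverage ratio is positive.
  by_cases hDβ : 0 < Dβ
  swap
  · refine ⟨1, 1, 1, 1, 1, one_pos, one_pos, one_pos, one_pos, one_pos, ?_⟩
    intro X A _ _ _ _ M πB πstar hcard hπB hπs hφ _ _ _ hu _ hβ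
    exfalso
    have h1 := hcov X A M πB πstar hπB hπs hφ hu
    refine hDβ ?_
    rw [hβ]
    exact mul_pos hκ (Real.sqrt_pos.2 (by
      by_contra h2
      nlinarith [sq_nonneg b]))
  have hd1 : (1 : ℝ) ≤ d := by exact_mod_cast hdpos
  have hDθ2 : 2 ≤ Dθ := by
    have hs : 1 ≤ √(d : ℝ) := Real.one_le_sqrt.2 hd1
    have : √(d : ℝ) ≤ √(d : ℝ) / (1 - γ) :=
      le_div_self (by positivity) (by linarith) (by linarith)
    linarith
  have hDθ0 : 0 < Dθ := by linarith
  have hc1 : c ≤ 1 := by rcases hc with rfl | rfl <;> norm_num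
  set e := (d : ℝ) ^ (2 - 2 * c) with hedef
  have he : 1 ≤ e := Real.one_le_rpow hd1 (by linarith)
  have he0 : 0 < e := by linarith
  have hl0 : 0 < Real.log N := by linarith
  have hKpos : 0 < ⌈360 * b ^ 4 * Dβ ^ 2 * Dθ ^ 2 / ε ^ 2⌉₊ := Nat.ceil_pos.2 (by positivity)
  have hTpos : 0 < ⌈1000 * b ^ 4 * e * Dβ ^ 2 * Dθ ^ 2 * Real.log N / ε ^ 2⌉₊ :=
    Nat.ceil_pos.2 (by positivity)
  -- The step sizes bring each of the three variance terms down to `ε/6`; `K` and `T` then do the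
  -- same for the three terms coming from the initial potentials.
  refine ⟨ε / (6 * b ^ 2 * Dθ ^ 2), ε / (27 * b ^ 4 * Dθ ^ 2 * e), ε / (30 * b ^ 4 * Dβ ^ 2),
    ⌈360 * b ^ 4 * Dβ ^ 2 * Dθ ^ 2 / ε ^ 2⌉₊,
    ⌈1000 * b ^ 4 * e * Dβ ^ 2 * Dθ ^ 2 * Real.log N / ε ^ 2⌉₊,
    by positivity, by positivity, by positivity, hKpos, hTpos, ?_⟩
  intro X A _ _ _ _ M πB πstar hcard hπB hπs hφ _ _ hθ hu hC hβ
  have hCov := hcov X A M πB πstar hπB hπs hφ hu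
  have hCov0 : 0 ≤ M.coverage c πstar πB := by
    by_contra h2
    nlinarith [sq_nonneg b]
  have hbβ : 1 ≤ b ^ 2 * Dβ ^ 2 :=
    hCov.trans (mul_le_mul_of_nonneg_left hC (sq_nonneg b))
  have hβ2 : Dβ ^ 2 = κ ^ 2 * M.coverage c πstar πB := by
    rw [hβ, mul_pow, Real.sq_sqrt hCov0]
  refine ⟨OfflineRL.sample_count_le hb1 hdpos hγ hγ1 hDθ hε hε1 hl hc1 hbβ hβ2, ?_⟩
  intro θ₀ β₁ hθ₀ hβ₁ Ω _ P _ W J hW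
  have : Nonempty A := Fintype.card_pos_iff.1 (by omega)
  have hadm : M.Admissible πB πstar ⟨c, ε / (6 * b ^ 2 * Dθ ^ 2), ε / (27 * b ^ 4 * Dθ ^ 2 * e),
      ε / (30 * b ^ 4 * Dβ ^ 2), Dθ, Dβ, ⌈360 * b ^ 4 * Dβ ^ 2 * Dθ ^ 2 / ε ^ 2⌉₊, θ₀, β₁⟩ b := by
    refine ⟨hγ, hγ1, hπB, hπs, M.cov_posDef hγ hγ1 hπB hu, hc, hb1,
      fun x a => (hφ x a).trans (hDφ.trans (le_max_left _ _)), hθ, hC, hDβ.le, by positivity,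
      by positivity, by positivity, hKpos, ?_, hθ₀, hβ₁⟩
    change ε / (6 * b ^ 2 * Dθ ^ 2) * (b * Dθ) ≤ 1
    have hbD : 1 ≤ b * Dθ := by nlinarith
    rw [div_mul_eq_mul_div, div_le_one (by positivity)]
    nlinarith
  refine (hadm.integral_suboptimality_le hTpos hW).trans ?_
  rw [hcard]
  exact OfflineRL.error_terms_le hb1 hDθ2 hDβ hbβ he hε hl rfl rfl (Nat.le_ceil _) (Nat.le_ceil _)
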